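/- For $\varepsilon>0$ and $\tau\in(-1,1)$ let $\varphi_{\varepsilon,\tau}(t)=\varepsilon\log\bigl(1+e^{(t-\tau)/\varepsilon}\bigr)$, $t\in\mathbb{R}$. For $n\ge 1$ let $$f_{\varepsilon,\tau}(x_1,\dots,x_n)=\frac12\sum_{i=1}^n\sum_{j=1}^n \varphi_{\varepsilon,\tau}(x_i^\top x_j),\qquad x_1,\dots,x_n\in\mathbb{S}^1=\{x\in\mathbb{R}^2:\|x\|=1\},$$ (the complete graph with unit weights, in dimension $d=2$), where $(\mathbb{S}^1)^n$ is a Riemannian submanifold of $(\mathbb{R}^2)^n$. Gradient flow is $\dot X(t)=\operatorname{grad} f_{\varepsilon,\tau}(X(t))$, $t\ge 0$, with the Riemannian gradient (so $f_{\varepsilon,\tau}$ is being maximized). A configuration is synchronized if $x_1=\cdots=x_n$, and a spurious local maximum is a local maximum of $f_{\varepsilon,\tau}$ on $(\mathbb{S}^1)^n$ that is not a global maximum. **Theorem.** For all $\varepsilon>0$ and $\tau\in(-1,1)$ the function $\varphi_{\varepsilon,\tau}$ is real-analytic on $\mathbb{R}$ and satisfies $\varphi_{\varepsilon,\tau}'(t)>0$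 and $\varphi_{\varepsilon,\tau}''(t)>0$ for all $t\in\mathbb{R}$. Moreover, there exist $\varepsilon>0$ and $\tau\in(-1,1)$ such that, for every $n\ge 5$, gradient flow for $f_{\varepsilon,\tau}$ from an initial configuration drawn uniformly at random from $(\mathbb{S}^1)^n$ converges with positive probability to a spurious local maximum of $f_{\varepsilon,\tau}$ that is not synchronized. -/

import Mathlib

open MeasureTheory Filter Topology

noncomputable section

namespace SphereSync

/-- The unit sphere `S^{d-1}` in `ℝ^d`. -/
abbrev Sphere (d : ℕ) : Type :=
  Metric.sphere (0 : EuclideanSpace ℝ (Fin d)) 1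

/-- Configurations of `n` points on the unit sphere: the manifold `(S^{d-1})^n`. -/
abbrev Config (d n : ℕ) : Type := Fin n → Sphere d

/-- The function `½ ∑_i ∑_j w_ij φ(⟨y_i, y_j⟩)` on the ambient space `(ℝ^d)^n`. -/
def ambientEnergy {d n : ℕ} (W : Matrix (Fin n) (Fin n) ℝ) (φ : ℝ → ℝ)
    (Y : Fin n → EuclideanSpace ℝ (Fin d)) : ℝ :=
  (1 / 2) * ∑ i, ∑ j, W i j * φ (inner ℝ (Y i) (Y j))

/-- The objective `f(x_1, …, x_n) = ½ ∑_i ∑_j w_ij φ(⟨x_i, x_j⟩)` on `(S^{d-1})^n`. -/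
def energy {d n : ℕ} (W : Matrix (Fin n) (Fin n) ℝ) (φ : ℝ → ℝ) (X : Config d n) : ℝ :=
  ambientEnergy W φ fun k => (X k : EuclideanSpace ℝ (Fin d))

/-- The `i`-th component of the Euclidean gradient of the ambient function at `Y`: the gradient
with respect to the `i`-th point `y_i`, the other points being held fixed. -/
def partialGradient {d n : ℕ} (W : Matrix (Fin n) (Fin n) ℝ) (φ : ℝ → ℝ)
    (Y : Fin n → EuclideanSpace ℝ (Fin d)) (i : Fin n) : EuclideanSpace ℝ (Fin d) :=
  gradient (fun y => ambientEnergy W φ (Function.update Y i y)) (Y i)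

/-- The `i`-th component of the Riemannian gradient of the objective at `X`, for the product
Riemannian structure that `(S^{d-1})^n` inherits as a submanifold of `(ℝ^d)^n`: the orthogonal
projection of the `i`-th component of the Euclidean gradient to the tangent space
`{v : ⟨x_i, v⟩ = 0}` of the sphere at `x_i`. -/
def riemannianGradient {d n : ℕ} (W : Matrix (Fin n) (Fin n) ℝ) (φ : ℝ → ℝ)
    (X : Config d n) (i : Fin n) : EuclideanSpace ℝ (Fin d) :=
  (Submodule.span ℝ {(X i : EuclideanSpace ℝ (Fin d))})ᗮ.starProjection
    (partialGradient W φ (fun k => (X k : EuclideanSpace ℝ (Fin d))) i)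

/-- `γ : [0, ∞) → (S^{d-1})^n` (values at negative times are irrelevant) is a trajectory of the
gradient flow maximizing the objective, `γ'(t) = grad f(γ(t))`, started at `X₀`. -/
def IsGradientFlow {d n : ℕ} (W : Matrix (Fin n) (Fin n) ℝ) (φ : ℝ → ℝ)
    (X₀ : Config d n) (γ : ℝ → Config d n) : Prop :=
  γ 0 = X₀ ∧ ∀ t : ℝ, 0 ≤ t → ∀ i : Fin n,
    HasDerivWithinAt (fun s => (γ s i : EuclideanSpace ℝ (Fin d)))
      (riemannianGradient W φ (γ t) i) (Set.Ici 0) t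

/-- Gradient flow started at `X₀` converges to `Y`: there is a trajectory defined for all times
`t ≥ 0`, and every such trajectory converges to `Y`. -/
def FlowConverges {d n : ℕ} (W : Matrix (Fin n) (Fin n) ℝ) (φ : ℝ → ℝ)
    (X₀ Y : Config d n) : Prop :=
  (∃ γ, IsGradientFlow W φ X₀ γ) ∧ ∀ γ, IsGradientFlow W φ X₀ γ → Tendsto γ atTop (𝓝 Y)

/-- All points of the configuration coincide. -/
def Synchronized {d n : ℕ} (X : Config d n) : Prop := ∀ i j, X i = X j

/-- A local maximum of the objective on `(S^{d-1})^n` that is not a global maximum. -/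
def IsSpuriousLocalMax {d n : ℕ} (W : Matrix (Fin n) (Fin n) ℝ) (φ : ℝ → ℝ)
    (X : Config d n) : Prop :=
  IsLocalMax (energy W φ) X ∧ ¬ ∀ Y : Config d n, energy W φ Y ≤ energy W φ X

/-- The uniform probability measure on `S^{d-1}`: the normalized surface measure. -/
def uniformSphere (d : ℕ) : Measure (Sphere d) :=
  ((volume : Measure (EuclideanSpace ℝ (Fin d))).toSphere Set.univ)⁻¹ •
    (volume : Measure (EuclideanSpace ℝ (Fin d))).toSphere

/-- The uniform distribution on `(S^{d-1})^n`: independent uniform points. -/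
def uniformConfig (d n : ℕ) : Measure (Config d n) :=
  Measure.pi fun _ => uniformSphere d

instance uniformSphere_isProbabilityMeasure (d : ℕ) [NeZero d] :
    IsProbabilityMeasure (uniformSphere d) := by
  constructor
  rw [uniformSphere, Measure.smul_apply, smul_eq_mul]
  refine ENNReal.inv_mul_cancel ?_ (measure_ne_top _ _)
  rw [Ne, Measure.measure_univ_eq_zero]
  exact Measure.toSphere_ne_zero _

instance uniformConfig_isProbabilityMeasure (d n : ℕ) [NeZero d] :
    IsProbabilityMeasure (uniformConfig d n) := by
  unfold uniformConfig
  infer_instance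

/-- The weights of the complete graph with unit weights: `w_ij = 1` for all `i, j`. -/
def unitWeights (n : ℕ) : Matrix (Fin n) (Fin n) ℝ := fun _ _ => 1

/-- The softplus function `φ_{ε,τ}(t) = ε log(1 + e^{(t-τ)/ε})`. -/
def softplus (ε τ : ℝ) (t : ℝ) : ℝ := ε * Real.log (1 + Real.exp ((t - τ) / ε))

end SphereSync

end

/-!
The maximum is found among configurations on the circle which stay close to a regular polygon.
Write `h x = φ (cos x)`; on angles the energy is `½ ∑ᵢⱼ h (θᵢ - θⱼ)`. As `ε → 0`, softplus tends to
`max (t - τ) 0`, so two points interact only if the cosine of their angle exceeds `τ`, and if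
`τ > 0` such an interaction is strictly concave in the angle, since `h''` tends to `-cos < -τ`.
A critical configuration none of whose pairs is at the threshold, and whose graph of interacting
pairs is connected, is then a local maximum, nondegenerate modulo rotation, for all small `ε`:
the interacting pairs control all pairs by a Poincaré inequality, and the remaining pairs
contribute to the Hessian an amount that tends to `0` (`isStableEquilibrium_of_poincare`).

The parameters `ε` and `τ` must serve all `n ≥ 5`, so two families of critical configurations are
used, with `1/5 < τ < 1/4`; the cosine of the central angle of a side of the regular pentagon is
`0.309…`.

* For `n` below a fixed bound, the regular `n`-gon is critical by symmetry. The threshold `τ` is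
  chosen outside the countable set of cosines of angles between vertices of regular polygons
  (`exists_threshold`), and each `n` needs its own smallness of `ε`
  (`eventually_isStableEquilibrium_regular_polygon`), which is harmless for finitely many `n`.
* For large `n`, the points are put into five clusters of nearly equal sizes. With equal weights
  the regular pentagon is a strict maximum of the energy of the clusters modulo rotation, because
  the cosine is strictly concave near its side. This persists for nearly equal weights and small
  `ε`, so that the maximum over a neighbourhood of the pentagon is interior, hence critical
  (`exists_balanced_near_pentagon`). Here the smallness of `ε` does not depend on `n`
  (`eventually_exists_isStableEquilibrium_clusters`).

A nondegenerate local maximum attracts an open set of initial configurations up to rotation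
(`IsStableEquilibrium.exists_basin`): lifted to angles, the flow preserves the mean angle and
contracts the squared distance to the equilibrium with that mean exponentially. Trajectories on the
sphere are unique (`IsGradientFlow.eq`), so they all come from this lift. Open sets have positive
uniform measure, and the limit is spurious because synchronized configurations have larger energy.
-/

noncomputable section

namespace SphereSync

/-! ### Angles on the circle -/

/-- The point of the circle at angle `x`. -/
def unitVec (x : ℝ) : Sphere 2 :=
  ⟨!₂[Real.cos x, Real.sin x], by simp [EuclideanSpace.norm_eq]⟩

lemma inner_unitVec (a b : ℝ) :
    inner ℝ (unitVec a : EuclideanSpace ℝ (Fin 2)) (unitVec b) = Real.cos (a - b) := by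
  simp [unitVec, PiLp.inner_apply, Real.cos_sub]
  ring

lemma hasDerivAt_unitVec (x : ℝ) :
    HasDerivAt (fun s => (unitVec s : EuclideanSpace ℝ (Fin 2)))
      !₂[-Real.sin x, Real.cos x] x := by
  rw [hasDerivAt_iff_hasFDerivAt, ← hasFDerivWithinAt_univ, hasFDerivWithinAt_piLp]
  intro i
  rw [hasFDerivWithinAt_univ, hasFDerivAt_iff_hasDerivAt]
  fin_cases i
  · simpa [unitVec] using Real.hasDerivAt_cos x
  · simpa [unitVec] using Real.hasDerivAt_sin x

lemma unitVec_sub_inner_smul (a b : ℝ) :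
    (unitVec b : EuclideanSpace ℝ (Fin 2)) - Real.cos (a - b) • (unitVec a : EuclideanSpace ℝ (Fin 2))
      = (-Real.sin (a - b)) • !₂[-Real.sin a, Real.cos a] := by
  have h := Real.sin_sq_add_cos_sq a
  ext i
  fin_cases i <;> simp [unitVec, Real.cos_sub, Real.sin_sub]
  · linear_combination -Real.cos b * h
  · linear_combination -Real.sin b * h

/-! ### The Riemannian gradient -/

/-- The pair `(i, j)` occurs twice in the double sum, which cancels the factor `1 / 2`. -/
lemma hasGradientAt_ambientEnergy {d n : ℕ} {φ : ℝ → ℝ} (hφ : Differentiable ℝ φ)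
    (Y : Fin n → EuclideanSpace ℝ (Fin d)) (i : Fin n) :
    HasGradientAt (fun y => ambientEnergy (unitWeights n) φ (Function.update Y i y))
      (∑ j, deriv φ (inner ℝ (Y i) (Y j)) • Y j) (Y i) := by
  have hupd : ∀ a, HasFDerivAt (fun y => Function.update Y i y a)
      (if a = i then ContinuousLinearMap.id ℝ (EuclideanSpace ℝ (Fin d)) else 0) (Y i) := by
    intro a
    rcases eq_or_ne a i with rfl | h
    · simpa using! hasFDerivAt_id (Y a)
    · simpa [h] using! hasFDerivAt_const (Y a) (Y i)
  rw [hasGradientAt_iff_hasFDerivAt]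
  have key := (HasFDerivAt.fun_sum (u := Finset.univ) fun a _ => HasFDerivAt.fun_sum
    (u := Finset.univ) fun b _ => ((hφ _).hasDerivAt.comp_hasFDerivAt (Y i)
      ((hupd a).inner ℝ (hupd b)))).const_mul (1 / 2 : ℝ)
  simp only [ambientEnergy, unitWeights, one_mul]
  refine key.congr_fderiv ?_
  ext v
  -- only the terms with `a = i` or `b = i` depend on `y`, and each family contributes one half
  have hite : ∀ a, (if a = i then ContinuousLinearMap.id ℝ (EuclideanSpace ℝ (Fin d)) else 0) v =
      if a = i then v else 0 := by
    intro a
    split_ifs <;> simp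
  have hl : ∀ a b, inner ℝ (Y a) (if b = i then v else 0) = if b = i then inner ℝ (Y a) v else 0 := by
    intro a b
    split_ifs <;> simp
  have hr : ∀ a b, inner ℝ (if a = i then v else 0) (Y b) = if a = i then inner ℝ v (Y b) else 0 := by
    intro a b
    split_ifs <;> simp
  simp only [Function.update_eq_self, Finset.sum_add_distrib, mul_add, hite, hl, hr,
    FunLike.coe_smul, sum_apply, Pi.smul_apply, ContinuousLinearMap.comp_apply,
    fderivInnerCLM_apply, ContinuousLinearMap.prod_apply, smul_eq_mul, mul_ite, mul_zero,
    Finset.sum_ite_eq', Finset.mem_univ, if_true, InnerProductSpace.toDual_apply_apply, sum_inner,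
    inner_smul_left, RCLike.conj_to_real]
  rw [Finset.sum_comm (f := fun a b => if a = i then _ else _)]
  simp only [Finset.sum_ite_eq', Finset.mem_univ, if_true]
  rw [← mul_add, ← Finset.sum_add_distrib, Finset.mul_sum]
  refine Finset.sum_congr rfl fun j _ => ?_
  rw [real_inner_comm (Y j) v, real_inner_comm (Y i) (Y j)]
  ring

lemma riemannianGradient_unitWeights {d n : ℕ} {φ : ℝ → ℝ} (hφ : Differentiable ℝ φ)
    (X : Config d n) (i : Fin n) :
    riemannianGradient (unitWeights n) φ X i =
      ∑ j, deriv φ (inner ℝ (X i : EuclideanSpace ℝ (Fin d)) (X j)) •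
        ((X j : EuclideanSpace ℝ (Fin d)) -
          inner ℝ (X i : EuclideanSpace ℝ (Fin d)) (X j) • (X i : EuclideanSpace ℝ (Fin d))) := by
  have hn : ‖(X i : EuclideanSpace ℝ (Fin d))‖ = 1 := by simp
  rw [riemannianGradient, partialGradient, (hasGradientAt_ambientEnergy hφ _ i).gradient,
    Submodule.starProjection_orthogonal_val, Submodule.starProjection_unit_singleton ℝ hn]
  simp only [inner_sum, inner_smul_right, Finset.sum_smul, ← Finset.sum_sub_distrib, smul_sub,
    smul_smul]
  
/-! ### Lifting the flow to angles -/

/-- The derivative of `x ↦ φ (cos x)`: the force along the circle between two points whose angles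
differ by `x`. -/
def angularForce (φ : ℝ → ℝ) (x : ℝ) : ℝ := -(deriv φ (Real.cos x) * Real.sin x)

lemma riemannianGradient_lift {n : ℕ} {φ : ℝ → ℝ} (hφ : Differentiable ℝ φ) (θ : Fin n → ℝ)
    (i : Fin n) :
    riemannianGradient (unitWeights n) φ (fun k => unitVec (θ k)) i =
      (∑ j, angularForce φ (θ i - θ j)) • !₂[-Real.sin (θ i), Real.cos (θ i)] := by
  rw [riemannianGradient_unitWeights hφ, Finset.sum_smul]
  refine Finset.sum_congr rfl fun j _ => ?_
  rw [inner_unitVec, unitVec_sub_inner_smul, smul_smul, angularForce, mul_neg]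

/-- A solution of the equation `θ_i' = ∑_j h'(θ_i - θ_j)`, where `h = φ ∘ cos`, projects to a
trajectory of the gradient flow. -/
lemma isGradientFlow_lift {n : ℕ} {φ : ℝ → ℝ} (hφ : Differentiable ℝ φ) {θ : ℝ → Fin n → ℝ}
    (hθ : ∀ t, 0 ≤ t → ∀ i, HasDerivWithinAt (fun s => θ s i)
      (∑ j, angularForce φ (θ t i - θ t j)) (Set.Ici 0) t) :
    IsGradientFlow (unitWeights n) φ (fun i => unitVec (θ 0 i)) (fun t i => unitVec (θ t i)) := by
  refine ⟨rfl, fun t ht i => ?_⟩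
  rw [riemannianGradient_lift hφ]
  exact (hasDerivAt_unitVec (θ t i)).scomp_hasDerivWithinAt t (hθ t ht i)

/-! ### Existence and uniqueness of trajectories -/

lemma exists_lipschitzOnWith_closedBall {E F : Type*} [NormedAddCommGroup E] [NormedSpace ℝ E]
    [FiniteDimensional ℝ E] [NormedAddCommGroup F] [NormedSpace ℝ F] {v : E → F}
    (hv : ContDiff ℝ 1 v) (x : E) (r : ℝ) :
    ∃ K, LipschitzOnWith K v (Metric.closedBall x r) := by
  have := FiniteDimensional.proper_real E
  exact hv.locallyLipschitz.locallyLipschitzOn.exists_lipschitzOnWith_of_compact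
    (isCompact_closedBall x r)

lemma contDiff_deriv_of_contDiff_two {φ : ℝ → ℝ} (hφ : ContDiff ℝ 2 φ) : ContDiff ℝ 1 (deriv φ) :=
  ((contDiff_succ_iff_deriv (n := 1)).1 (by simpa [one_add_one_eq_two] using hφ)).2.2

/-- Trajectories are unique. The formula for the Riemannian gradient extends to a `C¹` vector field on
the ambient space, to which the Gronwall inequality applies. -/
lemma IsGradientFlow.eq {d n : ℕ} {φ : ℝ → ℝ} (hφ : ContDiff ℝ 2 φ) {X₀ : Config d n}
    {γ γ' : ℝ → Config d n} (h : IsGradientFlow (unitWeights n) φ X₀ γ)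
    (h' : IsGradientFlow (unitWeights n) φ X₀ γ') {t : ℝ} (ht : 0 ≤ t) : γ t = γ' t := by
  have hφ' := contDiff_deriv_of_contDiff_two hφ
  have hd : Differentiable ℝ φ := hφ.differentiable (by norm_num)
  let V : (Fin n → EuclideanSpace ℝ (Fin d)) → Fin n → EuclideanSpace ℝ (Fin d) := fun Y i =>
    ∑ j, deriv φ (inner ℝ (Y i) (Y j)) • (Y j - inner ℝ (Y i) (Y j) • Y i)
  have hV : ContDiff ℝ 1 V := by
    rw [contDiff_pi]
    intro i
    refine ContDiff.sum fun j _ => ?_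
    have hin : ContDiff ℝ 1 fun Y : Fin n → EuclideanSpace ℝ (Fin d) => inner ℝ (Y i) (Y j) :=
      (contDiff_apply ℝ _ i).inner ℝ (contDiff_apply ℝ _ j)
    exact (hφ'.comp hin).smul ((contDiff_apply ℝ _ j).sub (hin.smul (contDiff_apply ℝ _ i)))
  obtain ⟨K, hK⟩ := exists_lipschitzOnWith_closedBall hV 0 1
  let emb : Config d n → Fin n → EuclideanSpace ℝ (Fin d) := fun X i => X i
  have hder : ∀ γ : ℝ → Config d n, IsGradientFlow (unitWeights n) φ X₀ γ → ∀ s, 0 ≤ s →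
      HasDerivWithinAt (fun s => emb (γ s)) (V (emb (γ s))) (Set.Ici 0) s := by
    intro γ hγ s hs
    rw [hasDerivWithinAt_pi]
    intro i
    have := hγ.2 s hs i
    rwa [riemannianGradient_unitWeights hd] at this
  have hball : ∀ X : Config d n, emb X ∈ Metric.closedBall 0 1 := by
    intro X
    rw [mem_closedBall_zero_iff, pi_norm_le_iff_of_nonneg zero_le_one]
    intro i
    simp [emb]
  have hcont : ∀ γ : ℝ → Config d n, IsGradientFlow (unitWeights n) φ X₀ γ →
      ContinuousOn (fun s => emb (γ s)) (Set.Icc 0 t) := fun γ hγ s hs =>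
    ((hder γ hγ s hs.1).continuousWithinAt).mono Set.Icc_subset_Ici_self
  have key := ODE_solution_unique_of_mem_Icc_right (v := fun _ => V) (K := K)
    (s := fun _ => Metric.closedBall 0 1) (fun _ _ => hK)
    (hcont γ h) (fun s hs => (hder γ h s hs.1).mono (Set.Ici_subset_Ici.2 hs.1))
    (fun _ _ => hball _)
    (hcont γ' h') (fun s hs => (hder γ' h' s hs.1).mono (Set.Ici_subset_Ici.2 hs.1))
    (fun _ _ => hball _) (by simp only [h.1, h'.1])
  have := key ⟨ht, le_rfl⟩
  funext i
  exact Subtype.ext (congrFun this i)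

/-- A bounded `C¹` autonomous vector field has solutions for all positive times: as the field is
bounded, the Picard-Lindelöf theorem applies on `[0, k + 1]` for every `k`, and the solutions are
glued by uniqueness. -/
lemma exists_forall_hasDerivWithinAt_of_bounded {E : Type*} [NormedAddCommGroup E]
    [NormedSpace ℝ E] [FiniteDimensional ℝ E] {v : E → E} (hv : ContDiff ℝ 1 v) {L : ℝ}
    (hL : ∀ x, ‖v x‖ ≤ L) (x₀ : E) :
    ∃ γ : ℝ → E, γ 0 = x₀ ∧ ∀ t, 0 ≤ t → HasDerivWithinAt γ (v (γ t)) (Set.Ici 0) t := by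
  have := FiniteDimensional.complete ℝ E
  have hL0 : 0 ≤ L := (norm_nonneg _).trans (hL x₀)
  have hloc : ∀ k : ℕ, ∃ α : ℝ → E, α 0 = x₀ ∧
      ∀ t ∈ Set.Icc (0 : ℝ) (k + 1), HasDerivWithinAt α (v (α t)) (Set.Icc 0 (k + 1)) t := by
    intro k
    have hk : (0 : ℝ) ≤ k + 1 := by positivity
    obtain ⟨K, hK⟩ := exists_lipschitzOnWith_closedBall hv x₀ (L * (k + 1))
    have hPL : IsPicardLindelof (fun _ => v) (⟨0, ⟨le_rfl, hk⟩⟩ : Set.Icc (0 : ℝ) (k + 1)) x₀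
        ⟨L * (k + 1), by positivity⟩ 0 ⟨L, hL0⟩ K :=
      { lipschitzOnWith := fun _ _ => hK
        continuousOn := fun _ _ => continuousOn_const
        norm_le := fun _ _ x _ => hL x
        mul_max_le := by
          simp only [sub_zero, sub_self, max_eq_left hk]
          simp only [NNReal.coe_zero, sub_zero]
          exact le_rfl }
    exact hPL.exists_eq_forall_mem_Icc_hasDerivWithinAt₀
  choose α hα0 hα using hloc
  have heq : ∀ k m : ℕ, k ≤ m → Set.EqOn (α k) (α m) (Set.Icc 0 (k + 1)) := by
    intro k m hkm
    have hsub : Set.Icc (0 : ℝ) (k + 1) ⊆ Set.Icc 0 (m + 1) :=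
      Set.Icc_subset_Icc_right (by gcongr)
    have hck : ContinuousOn (α k) (Set.Icc 0 (k + 1)) :=
      fun s hs => (hα k s hs).continuousWithinAt
    have hcm : ContinuousOn (α m) (Set.Icc 0 (k + 1)) :=
      fun s hs => (hα m s (hsub hs)).continuousWithinAt.mono hsub
    obtain ⟨R, hR⟩ := (((isCompact_Icc.image_of_continuousOn hck).union
      (isCompact_Icc.image_of_continuousOn hcm)).isBounded).subset_closedBall x₀
    obtain ⟨K, hK⟩ := exists_lipschitzOnWith_closedBall hv x₀ R
    refine ODE_solution_unique_of_mem_Icc_right (v := fun _ => v) (K := K)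
      (s := fun _ => Metric.closedBall x₀ R) (fun _ _ => hK) hck (fun s hs => ?_)
      (fun s hs => hR (Or.inl ⟨s, Set.Ico_subset_Icc_self hs, rfl⟩)) hcm (fun s hs => ?_)
      (fun s hs => hR (Or.inr ⟨s, Set.Ico_subset_Icc_self hs, rfl⟩)) (by rw [hα0, hα0])
    · exact (hα k s (Set.Ico_subset_Icc_self hs)).mono_of_mem_nhdsWithin
        (Icc_mem_nhdsGE_of_mem hs)
    · exact (hα m s (hsub (Set.Ico_subset_Icc_self hs))).mono_of_mem_nhdsWithin
        (Filter.mem_of_superset (Icc_mem_nhdsGE_of_mem hs) hsub)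
  have hγ : ∀ (m : ℕ) (s : ℝ), 0 ≤ s → s ≤ m → α ⌈s⌉₊ s = α m s := fun m s hs hsm =>
    heq _ m (Nat.ceil_le.2 hsm) ⟨hs, (Nat.le_ceil s).trans (by linarith)⟩
  refine ⟨fun t => α ⌈t⌉₊ t, hα0 _, fun t ht => ?_⟩
  have htm : t < (⌈t⌉₊ + 1 : ℕ) := by
    push_cast
    linarith [Nat.le_ceil t]
  have hmem : Set.Icc (0 : ℝ) (⌈t⌉₊ + 1 : ℕ) ∈ 𝓝[Set.Ici 0] t := by
    have : Set.Iio ((⌈t⌉₊ + 1 : ℕ) : ℝ) ∈ 𝓝 t := Iio_mem_nhds htm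
    filter_upwards [self_mem_nhdsWithin, mem_nhdsWithin_of_mem_nhds this] with s hs hs'
    exact ⟨hs, hs'.le⟩
  have h1 := (hα (⌈t⌉₊ + 1) t ⟨ht, by linarith⟩).mono
    (Set.Icc_subset_Icc_right (by linarith : ((⌈t⌉₊ + 1 : ℕ) : ℝ) ≤ (⌈t⌉₊ + 1 : ℕ) + 1))
  have h2 := h1.mono_of_mem_nhdsWithin hmem
  show HasDerivWithinAt _ (v (α ⌈t⌉₊ t)) _ _
  rw [hγ _ t ht htm.le]
  refine h2.congr_of_eventuallyEq ?_ (hγ _ t ht htm.le)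
  filter_upwards [hmem] with s hs
  exact hγ _ s hs.1 hs.2

/-! ### Stable equilibria -/

/-- The second derivative of `x ↦ φ (cos x)`. -/
def angularStiffness (φ : ℝ → ℝ) (x : ℝ) : ℝ :=
  deriv (deriv φ) (Real.cos x) * Real.sin x ^ 2 - deriv φ (Real.cos x) * Real.cos x

lemma hasDerivAt_comp_cos {φ : ℝ → ℝ} (hφ : Differentiable ℝ φ) (x : ℝ) :
    HasDerivAt (fun y => φ (Real.cos y)) (angularForce φ x) x := by
  have := (hφ (Real.cos x)).hasDerivAt.comp x (Real.hasDerivAt_cos x)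
  rwa [mul_neg] at this

lemma hasDerivAt_angularForce {φ : ℝ → ℝ} (hφ : ContDiff ℝ 2 φ) (x : ℝ) :
    HasDerivAt (angularForce φ) (angularStiffness φ x) x := by
  have hd := (contDiff_deriv_of_contDiff_two hφ).differentiable one_ne_zero
  have := (((hd (Real.cos x)).hasDerivAt.comp x (Real.hasDerivAt_cos x)).mul
    (Real.hasDerivAt_sin x)).neg
  refine this.congr_deriv ?_
  simp only [angularStiffness, Function.comp]
  ring

lemma continuous_angularStiffness {φ : ℝ → ℝ} (hφ : ContDiff ℝ 2 φ) :
    Continuous (angularStiffness φ) := by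
  have h1 := contDiff_deriv_of_contDiff_two hφ
  have h2 := h1.continuous_deriv le_rfl
  have h3 := h1.continuous
  unfold angularStiffness
  fun_prop

lemma contDiff_angularForce {φ : ℝ → ℝ} (hφ : ContDiff ℝ 2 φ) : ContDiff ℝ 1 (angularForce φ) :=
  (((contDiff_deriv_of_contDiff_two hφ).comp (Real.contDiff_cos.of_le le_top)).mul
    (Real.contDiff_sin.of_le le_top)).neg

lemma angularForce_neg (φ : ℝ → ℝ) (x : ℝ) : angularForce φ (-x) = -angularForce φ x := by
  simp [angularForce]

lemma exists_bound_angularForce {φ : ℝ → ℝ} (hφ : ContDiff ℝ 2 φ) :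
    ∃ M, ∀ x, |angularForce φ x| ≤ M := by
  obtain ⟨M, hM⟩ := (isCompact_Icc (a := (-1 : ℝ)) (b := 1)).exists_bound_of_continuousOn
    (contDiff_deriv_of_contDiff_two hφ).continuous.continuousOn
  refine ⟨M, fun x => ?_⟩
  rw [angularForce, abs_neg, abs_mul]
  have h := hM _ (Real.cos_mem_Icc x)
  calc _ ≤ M * 1 := mul_le_mul h (Real.abs_sin_le_one x) (abs_nonneg _) ((norm_nonneg _).trans h)
    _ = M := mul_one M

/-- Summation by parts for an antisymmetric array. -/
lemma sum_mul_sum_of_antisymm {ι : Type*} [Fintype ι] (v : ι → ℝ) {F : ι → ι → ℝ}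
    (hF : ∀ i j, F j i = -F i j) :
    2 * ∑ i, v i * ∑ j, F i j = ∑ i, ∑ j, (v i - v j) * F i j := by
  have h : ∑ i, ∑ j, v j * F i j = -∑ i, v i * ∑ j, F i j := by
    rw [Finset.sum_comm, ← Finset.sum_neg_distrib]
    refine Finset.sum_congr rfl fun i _ => ?_
    rw [Finset.mul_sum, ← Finset.sum_neg_distrib]
    exact Finset.sum_congr rfl fun j _ => by rw [hF i j]; ring
  simp only [sub_mul, Finset.sum_sub_distrib, h, ← Finset.mul_sum]
  ring

lemma sum_sum_eq_zero_of_antisymm {ι : Type*} [Fintype ι] {F : ι → ι → ℝ}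
    (hF : ∀ i j, F j i = -F i j) : ∑ i, ∑ j, F i j = 0 := by
  have := sum_mul_sum_of_antisymm (fun _ : ι => (1 : ℝ)) hF
  simpa using this

lemma sum_sum_sub_sq {n : ℕ} (v : Fin n → ℝ) (hv : ∑ i, v i = 0) :
    ∑ i, ∑ j, (v i - v j) ^ 2 = 2 * n * ∑ i, v i ^ 2 := by
  have : ∀ i, ∑ j, (v i - v j) ^ 2 = n * v i ^ 2 + ∑ j, v j ^ 2 := by
    intro i
    have : ∀ j, (v i - v j) ^ 2 = v i ^ 2 - 2 * v i * v j + v j ^ 2 := fun j => by ring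
    simp only [this, Finset.sum_add_distrib, Finset.sum_sub_distrib, ← Finset.mul_sum, hv]
    simp
  simp only [this, Finset.sum_add_distrib, ← Finset.mul_sum]
  simp
  ring

/-- Second order Taylor upper bounds for a function and its derivative. -/
lemma exists_forall_taylor_le {f f' f'' : ℝ → ℝ} (hf : ∀ x, HasDerivAt f (f' x) x)
    (hf' : ∀ x, HasDerivAt f' (f'' x) x) (hf'' : Continuous f'') (x : ℝ) {c : ℝ} (hc : 0 < c) :
    ∃ ρ > 0, ∀ s, |s| ≤ ρ → s * (f' (x + s) - f' x) ≤ (f'' x + c) * s ^ 2 ∧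
      f (x + s) ≤ f x + f' x * s + (f'' x + c) * s ^ 2 / 2 := by
  obtain ⟨ρ, hρ, hb⟩ := Metric.continuous_iff.1 hf'' x c hc
  -- both bounds are monotonicity in `t ∈ [0, 1]` along the segment `x + t * s`, which treats the
  -- two signs of `s` at once
  have hline : ∀ s t : ℝ, HasDerivAt (fun t => x + t * s) s t := fun s t => by
    simpa using ((hasDerivAt_id t).mul_const s).const_add x
  have h1 : ∀ s, |s| < ρ → s * (f' (x + s) - f' x) ≤ (f'' x + c) * s ^ 2 := by
    intro s hs
    have hd : ∀ t, HasDerivAt (fun t => (f'' x + c) * s ^ 2 * t - s * f' (x + t * s))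
        ((f'' x + c) * s ^ 2 - s * (f'' (x + t * s) * s)) t := fun t => by
      simpa using! ((hasDerivAt_id t).const_mul ((f'' x + c) * s ^ 2)).sub
        (((hf' _).comp t (hline s t)).const_mul s)
    have hm : MonotoneOn (fun t => (f'' x + c) * s ^ 2 * t - s * f' (x + t * s))
        (Set.Icc 0 1) := by
      refine monotoneOn_of_deriv_nonneg (convex_Icc 0 1)
        (fun t _ => (hd t).continuousAt.continuousWithinAt)
        (fun t _ => (hd t).differentiableAt.differentiableWithinAt) fun t ht => ?_
      rw [interior_Icc] at ht
      rw [(hd t).deriv]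
      have hts : dist (x + t * s) x < ρ := by
        rw [Real.dist_eq, add_sub_cancel_left, abs_mul, abs_of_pos ht.1]
        nlinarith [abs_nonneg s, ht.2]
      have := (abs_lt.1 (by simpa [Real.dist_eq] using hb _ hts)).2
      nlinarith [sq_nonneg s]
    have := hm (Set.left_mem_Icc.2 zero_le_one) (Set.right_mem_Icc.2 zero_le_one) zero_le_one
    simp only [mul_zero, zero_mul, add_zero, mul_one, one_mul] at this
    linarith
  refine ⟨ρ / 2, by positivity, fun s hs => ⟨h1 s (by linarith), ?_⟩⟩
  have hd : ∀ t, HasDerivAt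
      (fun t => f' x * s * t + (f'' x + c) * s ^ 2 / 2 * t ^ 2 - f (x + t * s))
      (f' x * s + (f'' x + c) * s ^ 2 / 2 * (2 * t) - f' (x + t * s) * s) t := fun t => by
    have h2 : HasDerivAt (fun t : ℝ => t ^ 2) (2 * t) t := by simpa using hasDerivAt_pow 2 t
    simpa using! (((hasDerivAt_id t).const_mul (f' x * s)).add
      (h2.const_mul ((f'' x + c) * s ^ 2 / 2))).sub ((hf _).comp t (hline s t))
  have hm : MonotoneOn (fun t => f' x * s * t + (f'' x + c) * s ^ 2 / 2 * t ^ 2 - f (x + t * s))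
      (Set.Icc 0 1) := by
    refine monotoneOn_of_deriv_nonneg (convex_Icc 0 1)
      (fun t _ => (hd t).continuousAt.continuousWithinAt)
      (fun t _ => (hd t).differentiableAt.differentiableWithinAt) fun t ht => ?_
    rw [interior_Icc] at ht
    rw [(hd t).deriv]
    have hts : |t * s| < ρ := by
      rw [abs_mul, abs_of_pos ht.1]
      nlinarith [abs_nonneg s, ht.2]
    have := h1 _ hts
    have : 0 ≤ t * (f' x * s + (f'' x + c) * s ^ 2 / 2 * (2 * t) - f' (x + t * s) * s) := by
      nlinarith
    exact nonneg_of_mul_nonneg_right this ht.1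
  have := hm (Set.left_mem_Icc.2 zero_le_one) (Set.right_mem_Icc.2 zero_le_one) zero_le_one
  simp only [mul_zero, zero_mul, add_zero, mul_one, one_mul] at this
  norm_num at this
  linarith

/-- The angles `θ` are a nondegenerate local maximum of the energy modulo rotation: the forces
balance, and the Hessian is negative definite modulo the constant vectors. Definiteness is stated
through the form `∑ᵢⱼ (vᵢ - vⱼ)²`, which vanishes exactly on constants. -/
structure IsStableEquilibrium {n : ℕ} (φ : ℝ → ℝ) (θ : Fin n → ℝ) : Prop where
  balanced : ∀ i, ∑ j, angularForce φ (θ i - θ j) = 0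
  hessian : ∃ c > 0, ∀ v : Fin n → ℝ,
    ∑ i, ∑ j, angularStiffness φ (θ i - θ j) * (v i - v j) ^ 2 ≤ -c * ∑ i, ∑ j, (v i - v j) ^ 2

lemma IsStableEquilibrium.add_const {n : ℕ} {φ : ℝ → ℝ} {θ : Fin n → ℝ}
    (h : IsStableEquilibrium φ θ) (m : ℝ) : IsStableEquilibrium φ (fun i => θ i + m) := by
  constructor
  · simpa using h.balanced
  · simpa using h.hessian

/-- The two consequences of stability that are used, both on a neighbourhood of `θ` which is invariant
under rotation: the angular vector field contracts towards `θ`, and `θ` maximizes the energy. -/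
lemma IsStableEquilibrium.exists_radius {n : ℕ} {φ : ℝ → ℝ} (hφ : ContDiff ℝ 2 φ) {θ : Fin n → ℝ}
    (h : IsStableEquilibrium φ θ) :
    ∃ c > 0, ∃ ρ > 0, ∀ v : Fin n → ℝ, (∀ i j, |v i - v j| ≤ ρ) →
      ∑ i, ∑ j, (v i - v j) * angularForce φ (θ i - θ j + (v i - v j)) ≤
        -c * ∑ i, ∑ j, (v i - v j) ^ 2 ∧
      ∑ i, ∑ j, φ (Real.cos (θ i - θ j + (v i - v j))) ≤ ∑ i, ∑ j, φ (Real.cos (θ i - θ j)) := by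
  obtain ⟨c, hc, hH⟩ := h.hessian
  have hdφ : Differentiable ℝ φ := hφ.differentiable (by norm_num)
  choose ρ hρ hT using fun p : Fin n × Fin n => exists_forall_taylor_le (hasDerivAt_comp_cos hdφ)
    (hasDerivAt_angularForce hφ) (continuous_angularStiffness hφ) (θ p.1 - θ p.2) (half_pos hc)
  obtain ⟨r, hr0, hr⟩ : ∃ r > 0, ∀ p, r ≤ ρ p := by
    have : ∀ᶠ r in 𝓝[>] (0 : ℝ), ∀ p, r ≤ ρ p :=
      eventually_all.2 fun p => (eventually_le_nhds (hρ p)).filter_mono nhdsWithin_le_nhds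
    obtain ⟨r, h1, h2⟩ := (this.and self_mem_nhdsWithin).exists
    exact ⟨r, h2, h1⟩
  refine ⟨c / 2, half_pos hc, r, hr0, fun v hv => ?_⟩
  -- the first-order terms cancel because the forces balance
  have hanti : ∑ i, ∑ j, (v i - v j) * angularForce φ (θ i - θ j) = 0 := by
    rw [← sum_mul_sum_of_antisymm v fun i j => by rw [← neg_sub, angularForce_neg]]
    simp [h.balanced]
  have hquad : ∑ i, ∑ j, (angularStiffness φ (θ i - θ j) + c / 2) * (v i - v j) ^ 2 ≤
      -(c / 2) * ∑ i, ∑ j, (v i - v j) ^ 2 := by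
    have := hH v
    simp only [add_mul, Finset.sum_add_distrib, ← Finset.mul_sum]
    linarith
  have hnn : 0 ≤ ∑ i, ∑ j, (v i - v j) ^ 2 :=
    Finset.sum_nonneg fun i _ => Finset.sum_nonneg fun j _ => sq_nonneg _
  constructor
  · have : ∑ i, ∑ j, (v i - v j) * angularForce φ (θ i - θ j + (v i - v j)) ≤
        ∑ i, ∑ j, ((v i - v j) * angularForce φ (θ i - θ j) +
          (angularStiffness φ (θ i - θ j) + c / 2) * (v i - v j) ^ 2) := by
      refine Finset.sum_le_sum fun i _ => Finset.sum_le_sum fun j _ => ?_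
      have := (hT (i, j) (v i - v j) ((hv i j).trans (hr _))).1
      simp only at this
      linarith
    simp only [Finset.sum_add_distrib, hanti] at this
    linarith
  · have : ∑ i, ∑ j, φ (Real.cos (θ i - θ j + (v i - v j))) ≤
        ∑ i, ∑ j, (φ (Real.cos (θ i - θ j)) + (v i - v j) * angularForce φ (θ i - θ j) +
          2⁻¹ * ((angularStiffness φ (θ i - θ j) + c / 2) * (v i - v j) ^ 2)) := by
      refine Finset.sum_le_sum fun i _ => Finset.sum_le_sum fun j _ => ?_
      have := (hT (i, j) (v i - v j) ((hv i j).trans (hr _))).2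
      simp only at this
      linarith
    simp only [Finset.sum_add_distrib, hanti, ← Finset.mul_sum] at this
    nlinarith

/-! ### Local angles -/

/-- Points of the circle near `unitVec x` have an angle near `x`. -/
lemma eventually_exists_angle (x : ℝ) {ρ : ℝ} (hρ : 0 < ρ) :
    ∀ᶠ p in 𝓝 (unitVec x), ∃ s, |s| < ρ ∧ p = unitVec (x + s) := by
  -- in complex notation `z p = p * exp (-i x)`, and the angle is `x + arg (z p)`
  let z : Sphere 2 → ℂ := fun p =>
    (⟨(p : EuclideanSpace ℝ (Fin 2)) 0, (p : EuclideanSpace ℝ (Fin 2)) 1⟩ : ℂ) *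
      Complex.exp (-x * Complex.I)
  have hz : ∀ p : Sphere 2, (⟨(p : EuclideanSpace ℝ (Fin 2)) 0, (p : EuclideanSpace ℝ (Fin 2)) 1⟩ : ℂ) =
      z p * Complex.exp (x * Complex.I) := by
    intro p
    simp [z, mul_assoc, ← Complex.exp_add]
  have hcont : Continuous z := by
    have : Continuous fun p : Sphere 2 =>
        (⟨(p : EuclideanSpace ℝ (Fin 2)) 0, (p : EuclideanSpace ℝ (Fin 2)) 1⟩ : ℂ) := by
      have h : Continuous fun p : Sphere 2 => Complex.equivRealProdCLM.symm
          ((p : EuclideanSpace ℝ (Fin 2)) 0, (p : EuclideanSpace ℝ (Fin 2)) 1) := by fun_prop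
      exact h
    exact this.mul continuous_const
  have hz1 : z (unitVec x) = 1 := by
    have : (⟨Real.cos x, Real.sin x⟩ : ℂ) = Complex.exp (x * Complex.I) := by
      rw [Complex.exp_mul_I]
      apply Complex.ext <;> simp [Complex.cos_ofReal_re, Complex.sin_ofReal_re]
    simp [z, unitVec, this, ← Complex.exp_add]
  have harg : Tendsto (fun p => Complex.arg (z p)) (𝓝 (unitVec x)) (𝓝 0) := by
    have h := (Complex.continuousAt_arg (x := z (unitVec x)) (by simp [hz1])).comp
      hcont.continuousAt
    simpa [ContinuousAt, hz1] using! h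
  filter_upwards [Metric.tendsto_nhds.1 harg ρ hρ] with p hp
  refine ⟨Complex.arg (z p), by simpa using hp, ?_⟩
  have hnorm : ‖z p‖ = 1 := by
    have h1 : ‖(p : EuclideanSpace ℝ (Fin 2))‖ = 1 := by simp
    have h2 : ‖(⟨(p : EuclideanSpace ℝ (Fin 2)) 0, (p : EuclideanSpace ℝ (Fin 2)) 1⟩ : ℂ)‖ = 1 := by
      rw [EuclideanSpace.norm_eq] at h1
      rw [Complex.norm_eq_sqrt_sq_add_sq]
      simpa using h1
    have h3 : ‖Complex.exp (-x * Complex.I)‖ = 1 := by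
      simpa using Complex.norm_exp_ofReal_mul_I (-x)
    rw [norm_mul, h2, h3, one_mul]
  have h := hz p
  rw [← Complex.norm_mul_exp_arg_mul_I (z p), hnorm, Complex.ofReal_one, one_mul,
    ← Complex.exp_add, ← add_mul, ← Complex.ofReal_add, add_comm] at h
  have hre := congrArg Complex.re h
  have him := congrArg Complex.im h
  rw [Complex.exp_ofReal_mul_I_re] at hre
  rw [Complex.exp_ofReal_mul_I_im] at him
  apply Subtype.ext
  ext i
  fin_cases i
  · simpa [unitVec] using hre
  · simpa [unitVec] using him

lemma continuous_unitVec : Continuous unitVec := by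
  refine Continuous.subtype_mk ?_ _
  fun_prop

/-! ### Convergence to a stable equilibrium -/

/-- The flow of angles starting near `θ` with the same mean converges to `θ`. The mean is conserved,
so `∑ i, (ϑ i - θ i) ^ 2` satisfies `D' ≤ -2 c n D` as long as it is at most `(ρ / 2) ^ 2`; it
therefore never crosses the barrier `(ρ / 2) ^ 2 * exp (-c n t)`. -/
lemma tendsto_of_angular_flow {n : ℕ} (hn : 0 < n) {φ : ℝ → ℝ} {θ : Fin n → ℝ} {c ρ : ℝ}
    (hc : 0 < c) (hρ : 0 < ρ)
    (hF : ∀ v : Fin n → ℝ, (∀ i j, |v i - v j| ≤ ρ) →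
      ∑ i, ∑ j, (v i - v j) * angularForce φ (θ i - θ j + (v i - v j)) ≤
        -c * ∑ i, ∑ j, (v i - v j) ^ 2)
    {ϑ : ℝ → Fin n → ℝ}
    (hϑ : ∀ t, 0 ≤ t → ∀ i, HasDerivWithinAt (fun s => ϑ s i)
      (∑ j, angularForce φ (ϑ t i - ϑ t j)) (Set.Ici 0) t)
    (hmean : ∑ i, (ϑ 0 i - θ i) = 0) (hinit : ∑ i, (ϑ 0 i - θ i) ^ 2 ≤ (ρ / 2) ^ 2) :
    Tendsto ϑ atTop (𝓝 θ) := by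
  have hn' : (0 : ℝ) < n := Nat.cast_pos.2 hn
  have hanti : ∀ t i j, angularForce φ (ϑ t j - ϑ t i) = -angularForce φ (ϑ t i - ϑ t j) :=
    fun t i j => by rw [← neg_sub, angularForce_neg]
  have hsum : ∀ t, 0 ≤ t → ∑ i, (ϑ t i - θ i) = 0 := by
    intro t ht
    have hd : ∀ s, 0 ≤ s → HasDerivWithinAt (fun s => ∑ i, (ϑ s i - θ i)) 0 (Set.Ici 0) s := by
      intro s hs
      have := HasDerivWithinAt.fun_sum (u := Finset.univ) fun i _ => (hϑ s hs i).sub_const (θ i)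
      rwa [sum_sum_eq_zero_of_antisymm (hanti s)] at this
    rw [← hmean]
    exact constant_of_has_deriv_right_zero
      (fun s hs => (hd s hs.1).continuousWithinAt.mono Set.Icc_subset_Ici_self)
      (fun s hs => (hd s hs.1).mono (Set.Ici_subset_Ici.2 hs.1)) t ⟨ht, le_rfl⟩
  have hD : ∀ s, 0 ≤ s → HasDerivWithinAt (fun s => ∑ i, (ϑ s i - θ i) ^ 2)
      (2 * ∑ i, (ϑ s i - θ i) * ∑ j, angularForce φ (ϑ s i - ϑ s j)) (Set.Ici 0) s := by
    intro s hs
    have := HasDerivWithinAt.fun_sum (u := Finset.univ) fun i _ =>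
      ((hϑ s hs i).sub_const (θ i)).pow 2
    refine this.congr_deriv ?_
    rw [Finset.mul_sum]
    refine Finset.sum_congr rfl fun i _ => ?_
    norm_num
    ring
  have hB : ∀ s, HasDerivAt (fun s => (ρ / 2) ^ 2 * Real.exp (-(c * n) * s))
      ((ρ / 2) ^ 2 * (Real.exp (-(c * n) * s) * -(c * n))) s := by
    intro s
    have := ((hasDerivAt_id s).const_mul (-(c * n))).exp.const_mul ((ρ / 2) ^ 2)
    simpa using this
  have hdecay : ∀ t, 0 ≤ t →
      ∑ i, (ϑ t i - θ i) ^ 2 ≤ (ρ / 2) ^ 2 * Real.exp (-(c * n) * t) := by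
    intro t ht
    refine image_le_of_deriv_right_lt_deriv_boundary'
      (fun s hs => (hD s hs.1).continuousWithinAt.mono Set.Icc_subset_Ici_self)
      (fun s hs => (hD s hs.1).mono (Set.Ici_subset_Ici.2 hs.1)) (by simpa using hinit)
      (fun s _ => (hB s).continuousAt.continuousWithinAt)
      (fun s _ => (hB s).hasDerivWithinAt) (fun s hs heq => ?_) ⟨ht, le_rfl⟩
    have hexp : Real.exp (-(c * n) * s) ≤ 1 :=
      Real.exp_le_one_iff.2 (by nlinarith [mul_pos hc hn', hs.1])
    have hpos : 0 < (ρ / 2) ^ 2 * Real.exp (-(c * n) * s) := by positivity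
    have hle : ∑ i, (ϑ s i - θ i) ^ 2 ≤ (ρ / 2) ^ 2 := by
      rw [heq]
      exact mul_le_of_le_one_right (by positivity) hexp
    have hcoord : ∀ i, |ϑ s i - θ i| ≤ ρ / 2 := fun i =>
      abs_le_of_sq_le_sq ((Finset.single_le_sum (f := fun i => (ϑ s i - θ i) ^ 2)
        (fun j _ => sq_nonneg _) (Finset.mem_univ i)).trans hle) (by positivity)
    have := hF (fun i => ϑ s i - θ i) fun i j => by
      have := abs_sub (ϑ s i - θ i) (ϑ s j - θ j)
      linarith [hcoord i, hcoord j]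
    rw [sum_sum_sub_sq _ (hsum s hs.1), heq] at this
    rw [sum_mul_sum_of_antisymm _ (hanti s)]
    have hcongr : ∑ i, ∑ j, (ϑ s i - θ i - (ϑ s j - θ j)) * angularForce φ (ϑ s i - ϑ s j) =
        ∑ i, ∑ j, (ϑ s i - θ i - (ϑ s j - θ j)) *
          angularForce φ (θ i - θ j + (ϑ s i - θ i - (ϑ s j - θ j))) := by
      refine Finset.sum_congr rfl fun i _ => Finset.sum_congr rfl fun j _ => ?_
      congr 2
      ring
    rw [hcongr]
    refine this.trans_lt ?_
    have := mul_pos (mul_pos hc hn') hpos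
    nlinarith
  have hlim : Tendsto (fun t : ℝ => (ρ / 2) ^ 2 * Real.exp (-(c * n) * t)) atTop (𝓝 0) := by
    have h1 : Tendsto (fun t : ℝ => -(c * n) * t) atTop atBot :=
      tendsto_id.const_mul_atTop_of_neg (by nlinarith [mul_pos hc hn'])
    simpa using (Real.tendsto_exp_atBot.comp h1).const_mul ((ρ / 2) ^ 2)
  rw [tendsto_pi_nhds]
  intro i
  have hsq : Tendsto (fun t => (ϑ t i - θ i) ^ 2) atTop (𝓝 0) := by
    refine tendsto_of_tendsto_of_tendsto_of_le_of_le' tendsto_const_nhds hlim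
      (Eventually.of_forall fun t => sq_nonneg _) ?_
    filter_upwards [eventually_ge_atTop 0] with t ht
    exact (Finset.single_le_sum (f := fun i => (ϑ t i - θ i) ^ 2)
        (fun j _ => sq_nonneg _) (Finset.mem_univ i)).trans (hdecay t ht)
  have habs : Tendsto (fun t => |ϑ t i - θ i|) atTop (𝓝 0) := by
    simpa [Real.sqrt_sq_eq_abs] using hsq.sqrt
  have := (tendsto_zero_iff_abs_tendsto_zero _).2 habs
  simpa using this.add_const (θ i)

lemma exists_angular_flow {n : ℕ} {φ : ℝ → ℝ} (hφ : ContDiff ℝ 2 φ) (θ₀ : Fin n → ℝ) :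
    ∃ ϑ : ℝ → Fin n → ℝ, ϑ 0 = θ₀ ∧ ∀ t, 0 ≤ t → ∀ i, HasDerivWithinAt (fun s => ϑ s i)
      (∑ j, angularForce φ (ϑ t i - ϑ t j)) (Set.Ici 0) t := by
  obtain ⟨M, hM⟩ := exists_bound_angularForce hφ
  have hM0 : 0 ≤ M := (abs_nonneg _).trans (hM 0)
  have hv : ContDiff ℝ 1 fun (θ : Fin n → ℝ) i => ∑ j, angularForce φ (θ i - θ j) := by
    rw [contDiff_pi]
    exact fun i => ContDiff.sum fun j _ => (contDiff_angularForce hφ).comp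
      ((contDiff_apply ℝ ℝ i).sub (contDiff_apply ℝ ℝ j))
  obtain ⟨ϑ, h0, hϑ⟩ := exists_forall_hasDerivWithinAt_of_bounded hv (L := n * M) (fun θ => by
    rw [pi_norm_le_iff_of_nonneg (by positivity)]
    intro i
    refine (norm_sum_le _ _).trans ?_
    simpa using Finset.sum_le_sum fun (j : Fin n) (_ : j ∈ Finset.univ) => hM (θ i - θ j)) θ₀
  exact ⟨ϑ, h0, fun t ht => hasDerivWithinAt_pi.1 (hϑ t ht)⟩

lemma energy_unitVec {n : ℕ} (φ : ℝ → ℝ) (θ : Fin n → ℝ) :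
    energy (unitWeights n) φ (fun i => unitVec (θ i)) =
      1 / 2 * ∑ i, ∑ j, φ (Real.cos (θ i - θ j)) := by
  simp [energy, ambientEnergy, unitWeights, inner_unitVec]

lemma eventually_exists_angles {n : ℕ} (θ : Fin n → ℝ) {ρ : ℝ} (hρ : 0 < ρ) :
    ∀ᶠ X : Config 2 n in 𝓝 (fun i => unitVec (θ i)),
      ∃ s : Fin n → ℝ, (∀ i, |s i| < ρ) ∧ X = fun i => unitVec (θ i + s i) := by
  have : ∀ᶠ X : Config 2 n in 𝓝 (fun i => unitVec (θ i)),
      ∀ i, ∃ s, |s| < ρ ∧ X i = unitVec (θ i + s) :=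
    eventually_all.2 fun i => ((continuous_apply i).tendsto fun i => unitVec (θ i)).eventually
      (eventually_exists_angle (θ i) hρ)
  filter_upwards [this] with X hX
  choose s hs hX using hX
  exact ⟨s, hs, funext hX⟩

/-- A local maximum with two distinct points is spurious, since synchronized configurations maximize
every pair interaction. -/
lemma isSpuriousLocalMax_of_forall_le {n : ℕ} {φ : ℝ → ℝ} (hφ : StrictMono φ) {θ : Fin n → ℝ}
    {ρ : ℝ} (hρ : 0 < ρ)
    (hmax : ∀ v : Fin n → ℝ, (∀ i j, |v i - v j| ≤ ρ) →
      ∑ i, ∑ j, φ (Real.cos (θ i - θ j + (v i - v j))) ≤ ∑ i, ∑ j, φ (Real.cos (θ i - θ j)))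
    (hθ : ∃ i j, Real.cos (θ i - θ j) ≠ 1) :
    IsSpuriousLocalMax (unitWeights n) φ (fun i => unitVec (θ i)) := by
  constructor
  · filter_upwards [eventually_exists_angles θ (half_pos hρ)] with X hX
    obtain ⟨s, hs, rfl⟩ := hX
    rw [energy_unitVec φ (fun i => θ i + s i), energy_unitVec]
    have := hmax s fun i j => by
      have := abs_sub (s i) (s j)
      linarith [hs i, hs j]
    simp only [add_sub_add_comm]
    linarith
  · intro hglob
    obtain ⟨i₀, j₀, hne⟩ := hθ
    have h0 := hglob fun _ => unitVec 0
    rw [energy_unitVec φ (fun _ => 0), energy_unitVec] at h0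
    have : ∑ i, ∑ j, φ (Real.cos (θ i - θ j)) <
        ∑ i : Fin n, ∑ j : Fin n, φ (Real.cos (0 - 0)) := by
      have hle : ∀ i j, φ (Real.cos (θ i - θ j)) ≤ φ (Real.cos (0 - 0)) := fun i j =>
        hφ.monotone (by simpa using Real.cos_le_one _)
      refine Finset.sum_lt_sum (fun i _ => Finset.sum_le_sum fun j _ => hle i j)
        ⟨i₀, Finset.mem_univ _, Finset.sum_lt_sum (fun j _ => hle i₀ j)
          ⟨j₀, Finset.mem_univ _, hφ ?_⟩⟩
      simpa using lt_of_le_of_ne (Real.cos_le_one _) hne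
    simp only [sub_self, Real.cos_zero] at h0 this
    linarith

/-- A stable equilibrium with two distinct points attracts, up to rotation, an open set of initial
configurations. -/
theorem IsStableEquilibrium.exists_basin {n : ℕ} {φ : ℝ → ℝ} (hφ : ContDiff ℝ 2 φ)
    (hmono : StrictMono φ) {θ : Fin n → ℝ} (h : IsStableEquilibrium φ θ)
    (hθ : ∃ i j, Real.cos (θ i - θ j) ≠ 1) :
    ∃ B : Set (Config 2 n), MeasurableSet B ∧ 0 < uniformConfig 2 n B ∧
      ∀ X₀ ∈ B, ∃ Y : Config 2 n, IsSpuriousLocalMax (unitWeights n) φ Y ∧ ¬ Synchronized Y ∧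
        FlowConverges (unitWeights n) φ X₀ Y := by
  obtain ⟨c, hc, ρ, hρ, hF⟩ := h.exists_radius hφ
  have hn : 0 < n := by
    obtain ⟨i, -⟩ := hθ
    exact i.pos
  have hn' : (1 : ℝ) ≤ n := Nat.one_le_cast.2 hn
  -- with initial displacements below `ρ / (4 n)`, the centred ones are below `ρ / (2 n)` and their
  -- sum of squares is at most `(ρ / 2) ^ 2`
  have hδ : 0 < ρ / (4 * n) := by positivity
  obtain ⟨B, hB, hBo, hBmem⟩ := eventually_nhds_iff.1 (eventually_exists_angles θ hδ)
  have hpos : (uniformConfig 2 n).IsOpenPosMeasure := by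
    have : (uniformSphere 2).IsOpenPosMeasure := by
      unfold uniformSphere
      exact Measure.isOpenPosMeasure_smul _ (ENNReal.inv_ne_zero.2 (measure_ne_top _ _))
    exact Measure.pi.isOpenPosMeasure (fun _ : Fin n => uniformSphere 2)
  refine ⟨B, hBo.measurableSet, hBo.measure_pos _ ⟨_, hBmem⟩, fun X₀ hX₀ => ?_⟩
  obtain ⟨s, hs, rfl⟩ := hB X₀ hX₀
  -- the limit is the rotation of `θ` by the mean angular displacement, which the flow preserves
  set m : ℝ := (∑ i, s i) / n with hm
  have hmabs : |m| ≤ ρ / (4 * n) := by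
    rw [hm, abs_div, Nat.abs_cast, div_le_iff₀ (by positivity)]
    refine (Finset.abs_sum_le_sum_abs _ _).trans ?_
    refine (Finset.sum_le_sum fun i _ => (hs i).le).trans ?_
    simp [mul_comm]
  have hF' : ∀ v : Fin n → ℝ, (∀ i j, |v i - v j| ≤ ρ) →
      ∑ i, ∑ j, (v i - v j) * angularForce φ ((θ i + m) - (θ j + m) + (v i - v j)) ≤
        -c * ∑ i, ∑ j, (v i - v j) ^ 2 := fun v hv => by
    simpa using (hF v hv).1
  have hflow : ∀ ϑ : ℝ → Fin n → ℝ, ϑ 0 = (fun i => θ i + s i) →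
      (∀ t, 0 ≤ t → ∀ i, HasDerivWithinAt (fun s => ϑ s i)
        (∑ j, angularForce φ (ϑ t i - ϑ t j)) (Set.Ici 0) t) →
      Tendsto ϑ atTop (𝓝 fun i => θ i + m) := by
    intro ϑ h0 hϑ
    refine tendsto_of_angular_flow hn hc hρ hF' hϑ ?_ ?_
    · have : ∀ i, θ i + s i - (θ i + m) = s i - m := fun i => by ring
      simp only [h0, this, Finset.sum_sub_distrib]
      simp [hm]
      field_simp
      simp
    · have : ∀ i, θ i + s i - (θ i + m) = s i - m := fun i => by ring
      simp only [h0, this]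
      have hb : ∀ i ∈ Finset.univ, (s i - m) ^ 2 ≤ (2 * (ρ / (4 * n))) ^ 2 := fun i _ => by
        rw [sq_le_sq, abs_of_pos (by positivity : 0 < 2 * (ρ / (4 * n)))]
        linarith [abs_sub (s i) m, hs i]
      refine (Finset.sum_le_sum hb).trans ?_
      rw [Finset.sum_const, Finset.card_univ, Fintype.card_fin, nsmul_eq_mul]
      have : (n : ℝ) * (2 * (ρ / (4 * n))) ^ 2 = (ρ / 2) ^ 2 / n := by
        field_simp
        ring
      rw [this]
      exact div_le_self (sq_nonneg _) hn'
  refine ⟨fun i => unitVec (θ i + m), ?_, ?_, ?_⟩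
  · refine isSpuriousLocalMax_of_forall_le hmono (θ := fun i => θ i + m) hρ (fun v hv => ?_) ?_
    · simpa using (hF v hv).2
    · simpa using hθ
  · intro hsync
    obtain ⟨i, j, hij⟩ := hθ
    apply hij
    have := inner_unitVec (θ i + m) (θ j + m)
    have hij' : unitVec (θ i + m) = unitVec (θ j + m) := hsync i j
    rw [hij', inner_unitVec] at this
    simpa using this.symm
  · obtain ⟨ϑ, h0, hϑ⟩ := exists_angular_flow hφ (fun i => θ i + s i)
    have hγ := isGradientFlow_lift (hφ.differentiable (by norm_num)) hϑ
    rw [h0] at hγ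
    refine ⟨⟨_, hγ⟩, fun γ hγ' => ?_⟩
    have hlim : Tendsto (fun t i => unitVec (ϑ t i)) atTop (𝓝 fun i => unitVec (θ i + m)) :=
      tendsto_pi_nhds.2 fun i => (continuous_unitVec.tendsto _).comp
        (tendsto_pi_nhds.1 (hflow ϑ h0 hϑ) i)
    refine hlim.congr' ?_
    filter_upwards [eventually_ge_atTop 0] with t ht
    exact hγ.eq hφ hγ' ht

/-! ### The softplus function -/

lemma analyticOnNhd_softplus (ε τ : ℝ) : AnalyticOnNhd ℝ (softplus ε τ) Set.univ := by
  intro t _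
  have h : AnalyticAt ℝ (fun t => 1 + Real.exp ((t - τ) / ε)) t := by
    refine analyticAt_const.add (AnalyticAt.rexp ?_)
    exact (analyticAt_id.sub analyticAt_const).div_const
  exact analyticAt_const.mul (h.log (by positivity))

lemma hasDerivAt_softplus {ε : ℝ} (hε : 0 < ε) (τ t : ℝ) :
    HasDerivAt (softplus ε τ) (Real.exp ((t - τ) / ε) / (1 + Real.exp ((t - τ) / ε))) t := by
  have h1 := ((((hasDerivAt_id t).sub_const τ).div_const ε).exp.const_add 1).log
    (by positivity)
  refine (h1.const_mul ε).congr_deriv ?_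
  simp only [id]
  field_simp

lemma deriv_softplus {ε : ℝ} (hε : 0 < ε) (τ : ℝ) :
    deriv (softplus ε τ) =
      fun t => Real.exp ((t - τ) / ε) / (1 + Real.exp ((t - τ) / ε)) :=
  funext fun t => (hasDerivAt_softplus hε τ t).deriv

lemma deriv_deriv_softplus {ε : ℝ} (hε : 0 < ε) (τ t : ℝ) :
    deriv (deriv (softplus ε τ)) t =
      Real.exp ((t - τ) / ε) / (1 + Real.exp ((t - τ) / ε)) ^ 2 / ε := by
  rw [deriv_softplus hε]
  have h1 := (((hasDerivAt_id t).sub_const τ).div_const ε).exp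
  have h2 := h1.div (h1.const_add 1) (by positivity)
  refine (h2.congr_deriv ?_).deriv
  simp only [id]
  field_simp
  ring

lemma deriv_softplus_pos {ε : ℝ} (hε : 0 < ε) (τ t : ℝ) : 0 < deriv (softplus ε τ) t := by
  rw [deriv_softplus hε]
  positivity

lemma deriv_deriv_softplus_pos {ε : ℝ} (hε : 0 < ε) (τ t : ℝ) :
    0 < deriv (deriv (softplus ε τ)) t := by
  rw [deriv_deriv_softplus hε]
  positivity

lemma contDiff_softplus (ε τ : ℝ) : ContDiff ℝ 2 (softplus ε τ) :=
  contDiff_iff_contDiffAt.2 fun t => (analyticOnNhd_softplus ε τ t trivial).contDiffAt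

lemma strictMono_softplus {ε : ℝ} (hε : 0 < ε) (τ : ℝ) : StrictMono (softplus ε τ) :=
  strictMono_of_deriv_pos (deriv_softplus_pos hε τ)

lemma softplus_nonneg {ε : ℝ} (hε : 0 < ε) (τ t : ℝ) : 0 ≤ softplus ε τ t :=
  mul_nonneg hε.le (Real.log_nonneg (by linarith [Real.exp_pos ((t - τ) / ε)]))

lemma sub_le_softplus {ε : ℝ} (hε : 0 < ε) (τ t : ℝ) : t - τ ≤ softplus ε τ t := by
  have h : (t - τ) / ε ≤ Real.log (1 + Real.exp ((t - τ) / ε)) := by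
    rw [Real.le_log_iff_exp_le (by positivity)]
    linarith
  calc t - τ = ε * ((t - τ) / ε) := by field_simp
    _ ≤ _ := mul_le_mul_of_nonneg_left h hε.le

lemma softplus_le {ε : ℝ} (hε : 0 < ε) (τ t : ℝ) : softplus ε τ t ≤ max (t - τ) 0 + ε := by
  have h : Real.log (1 + Real.exp ((t - τ) / ε)) ≤ max (t - τ) 0 / ε + 1 := by
    rw [Real.log_le_iff_le_exp (by positivity), Real.exp_add]
    have h1 : Real.exp ((t - τ) / ε) ≤ Real.exp (max (t - τ) 0 / ε) :=
      Real.exp_le_exp.2 (by gcongr; exact le_max_left _ _)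
    have h2 : 1 ≤ Real.exp (max (t - τ) 0 / ε) :=
      Real.one_le_exp (div_nonneg (le_max_right _ _) hε.le)
    have h3 := Real.add_one_le_exp 1
    nlinarith
  calc softplus ε τ t ≤ ε * (max (t - τ) 0 / ε + 1) := mul_le_mul_of_nonneg_left h hε.le
    _ = _ := by field_simp

lemma exp_neg_div_le {ε δ : ℝ} (hε : 0 < ε) (hδ : 0 < δ) :
    Real.exp (-(δ / ε)) ≤ ε / δ ∧ Real.exp (-(δ / ε)) / ε ≤ 2 * ε / δ ^ 2 := by
  have hx : 0 < δ / ε := div_pos hδ hε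
  constructor
  · rw [Real.exp_neg, inv_le_comm₀ (Real.exp_pos _) (by positivity), inv_div]
    linarith [Real.add_one_le_exp (δ / ε)]
  · have h := Real.quadratic_le_exp_of_nonneg hx.le
    have h2 : Real.exp (-(δ / ε)) ≤ 2 * ε ^ 2 / δ ^ 2 := by
      rw [Real.exp_neg, inv_le_comm₀ (Real.exp_pos _) (by positivity), inv_div]
      have : δ ^ 2 / (2 * ε ^ 2) = (δ / ε) ^ 2 / 2 := by field_simp
      rw [this]
      linarith
    calc _ ≤ 2 * ε ^ 2 / δ ^ 2 / ε := by gcongr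
      _ = _ := by field_simp

lemma angularStiffness_softplus_le_of_le {ε δ τ x : ℝ} (hε : 0 < ε) (hδ : 0 < δ)
    (hx : Real.cos x ≤ τ - δ) :
    angularStiffness (softplus ε τ) x ≤ 2 * ε / δ ^ 2 + ε / δ := by
  obtain ⟨h1, h2⟩ := exp_neg_div_le hε hδ
  have hu : Real.exp ((Real.cos x - τ) / ε) ≤ Real.exp (-(δ / ε)) :=
    Real.exp_le_exp.2 (by rw [← neg_div]; gcongr; linarith)
  have hpos := Real.exp_pos ((Real.cos x - τ) / ε)
  have hd1 : deriv (softplus ε τ) (Real.cos x) ≤ ε / δ := by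
    rw [deriv_softplus hε]
    exact (div_le_self hpos.le (by linarith)).trans (hu.trans h1)
  have hd2 : deriv (deriv (softplus ε τ)) (Real.cos x) ≤ 2 * ε / δ ^ 2 := by
    rw [deriv_deriv_softplus hε]
    refine le_trans ?_ h2
    gcongr
    exact (div_le_self hpos.le (one_le_pow₀ (by linarith))).trans hu
  have hp1 := deriv_softplus_pos hε τ (Real.cos x)
  have hp2 := deriv_deriv_softplus_pos hε τ (Real.cos x)
  have hs := Real.sin_sq_le_one x
  have hc := Real.neg_one_le_cos x
  unfold angularStiffness
  nlinarith

lemma angularStiffness_softplus_le_of_ge {ε δ τ x : ℝ} (hε : 0 < ε) (hδ : 0 < δ)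
    (hτ : 0 < τ) (hx : τ + δ ≤ Real.cos x) :
    angularStiffness (softplus ε τ) x ≤ 2 * ε / δ ^ 2 + ε / δ - τ := by
  obtain ⟨h1, h2⟩ := exp_neg_div_le hε hδ
  have hpos := Real.exp_pos ((Real.cos x - τ) / ε)
  have hu : 1 ≤ Real.exp ((Real.cos x - τ) / ε) * Real.exp (-(δ / ε)) := by
    rw [← Real.exp_add]
    refine Real.one_le_exp ?_
    rw [← sub_eq_add_neg, ← sub_div]
    exact div_nonneg (by linarith) hε.le
  have hd1 : 1 - ε / δ ≤ deriv (softplus ε τ) (Real.cos x) := by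
    rw [deriv_softplus hε]
    simp only
    rw [le_div_iff₀ (by positivity)]
    nlinarith [div_pos hε hδ]
  have hd2 : deriv (deriv (softplus ε τ)) (Real.cos x) ≤ 2 * ε / δ ^ 2 := by
    rw [deriv_deriv_softplus hε]
    refine le_trans ?_ h2
    gcongr
    rw [div_le_iff₀ (by positivity)]
    nlinarith [Real.exp_pos (-(δ / ε))]
  have hp1 := deriv_softplus_pos hε τ (Real.cos x)
  have hp2 := deriv_deriv_softplus_pos hε τ (Real.cos x)
  have hs := Real.sin_sq_le_one x
  have hc := Real.cos_le_one x
  have ha : deriv (deriv (softplus ε τ)) (Real.cos x) * Real.sin x ^ 2 ≤ 2 * ε / δ ^ 2 := by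
    nlinarith [sq_nonneg (Real.sin x)]
  have hcos : 0 < Real.cos x := by linarith
  have hb : τ - ε / δ ≤ deriv (softplus ε τ) (Real.cos x) * Real.cos x := by
    nlinarith [div_pos hε hδ]
  unfold angularStiffness
  linarith

/-- As `ε → 0`, pairs at distance beyond the threshold stop interacting, and pairs within it
interact through a strictly concave function of the angle. -/
lemma eventually_angularStiffness_softplus_le {τ δ η : ℝ} (hτ : 0 < τ) (hδ : 0 < δ) (hη : 0 < η) :
    ∀ᶠ ε in 𝓝[>] (0 : ℝ), ∀ x,
      (τ + δ ≤ Real.cos x → angularStiffness (softplus ε τ) x ≤ -(τ / 2)) ∧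
      (Real.cos x ≤ τ - δ → angularStiffness (softplus ε τ) x ≤ η) := by
  have hlim : Tendsto (fun ε : ℝ => 2 * ε / δ ^ 2 + ε / δ) (𝓝 0) (𝓝 0) := by
    have : Continuous fun ε : ℝ => 2 * ε / δ ^ 2 + ε / δ := by fun_prop
    simpa using this.tendsto 0
  have h1 := (hlim.eventually (gt_mem_nhds (lt_min hη (half_pos hτ)))).filter_mono
    (nhdsWithin_le_nhds (s := Set.Ioi 0))
  filter_upwards [h1, self_mem_nhdsWithin] with ε h hε x
  obtain ⟨ha, hb⟩ := lt_min_iff.1 h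
  exact ⟨fun hx => (angularStiffness_softplus_le_of_ge hε hδ hτ hx).trans (by linarith),
    fun hx => (angularStiffness_softplus_le_of_le hε hδ hx).trans ha.le⟩

/-! ### A criterion for stability -/

/-- If all pairs are away from the threshold and the graph of pairs within it is connected, in the
quantitative form of a Poincaré inequality with constant `K`, a balanced configuration is a stable
equilibrium. -/
lemma isStableEquilibrium_of_poincare {n : ℕ} {φ : ℝ → ℝ} {θ : Fin n → ℝ} {τ δ K a : ℝ}
    (hK : 0 < K) (ha : 0 < a) (hδ : 0 < δ)
    (hbal : ∀ i, ∑ j, angularForce φ (θ i - θ j) = 0)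
    (hsep : ∀ i j, τ + δ ≤ Real.cos (θ i - θ j) ∨ Real.cos (θ i - θ j) ≤ τ - δ)
    (hpoinc : ∀ v : Fin n → ℝ, ∑ i, ∑ j, (v i - v j) ^ 2 ≤
      K * ∑ i, ∑ j, if τ < Real.cos (θ i - θ j) then (v i - v j) ^ 2 else 0)
    (hS : ∀ x, (τ + δ ≤ Real.cos x → angularStiffness φ x ≤ -a) ∧
      (Real.cos x ≤ τ - δ → angularStiffness φ x ≤ a / (2 * K))) :
    IsStableEquilibrium φ θ := by
  refine ⟨hbal, a / (2 * K), by positivity, fun v => ?_⟩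
  have hterm : ∀ i j, angularStiffness φ (θ i - θ j) * (v i - v j) ^ 2 ≤
      a / (2 * K) * (v i - v j) ^ 2 -
        a * (if τ < Real.cos (θ i - θ j) then (v i - v j) ^ 2 else 0) := by
    intro i j
    have hsq := sq_nonneg (v i - v j)
    have hq : 0 < a / (2 * K) := by positivity
    rcases hsep i j with h | h
    · rw [if_pos (by linarith)]
      nlinarith [(hS (θ i - θ j)).1 h]
    · rw [if_neg (by linarith)]
      nlinarith [(hS (θ i - θ j)).2 h]
  have hsum := Finset.sum_le_sum fun i (_ : i ∈ Finset.univ) =>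
    Finset.sum_le_sum fun j (_ : j ∈ Finset.univ) => hterm i j
  simp only [Finset.sum_sub_distrib, ← Finset.mul_sum] at hsum
  have hp := mul_le_mul_of_nonneg_left (hpoinc v) (by positivity : 0 ≤ a / K)
  have e1 : a / K * (K * ∑ i, ∑ j, if τ < Real.cos (θ i - θ j) then (v i - v j) ^ 2 else 0) =
      a * ∑ i, ∑ j, if τ < Real.cos (θ i - θ j) then (v i - v j) ^ 2 else 0 := by
    field_simp
  have e2 : a / K = 2 * (a / (2 * K)) := by field_simp
  rw [e1, e2] at hp
  linarith

/-- Poincaré inequality for a graph on `Fin n` containing the path `0, 1, …, n - 1`. -/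
lemma poincare_of_path {n : ℕ} {R : Fin n → Fin n → Prop} [DecidableRel R]
    (hR : ∀ (k : ℕ) (h : k + 1 < n), R ⟨k + 1, h⟩ ⟨k, by omega⟩) (v : Fin n → ℝ) :
    ∑ i, ∑ j, (v i - v j) ^ 2 ≤
      (4 * n ^ 4 : ℝ) * ∑ i, ∑ j, if R i j then (v i - v j) ^ 2 else 0 := by
  set G := ∑ i, ∑ j, if R i j then (v i - v j) ^ 2 else 0 with hG
  have hnn : ∀ i j, 0 ≤ if R i j then (v i - v j) ^ 2 else 0 := fun i j => by
    split_ifs <;> positivity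
  have hedge : ∀ i j, R i j → |v i - v j| ≤ √G := by
    intro i j hij
    refine Real.abs_le_sqrt ?_
    calc (v i - v j) ^ 2 = if R i j then (v i - v j) ^ 2 else 0 := by rw [if_pos hij]
      _ ≤ ∑ j, if R i j then (v i - v j) ^ 2 else 0 :=
        Finset.single_le_sum (fun j _ => hnn i j) (Finset.mem_univ j)
      _ ≤ G := Finset.single_le_sum
        (f := fun i => ∑ j, if R i j then (v i - v j) ^ 2 else 0)
        (fun i _ => Finset.sum_nonneg fun j _ => hnn i j) (Finset.mem_univ i)
  have hG0 : 0 ≤ G := Finset.sum_nonneg fun i _ => Finset.sum_nonneg fun j _ => hnn i j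
  have hpath : ∀ (k : ℕ) (h : k < n), |v ⟨k, h⟩ - v ⟨0, by omega⟩| ≤ k * √G := by
    intro k
    induction k with
    | zero => simp
    | succ k ih =>
      intro h
      have h1 := ih (by omega)
      have h2 := hedge _ _ (hR k h)
      have h3 := abs_sub_le (v ⟨k + 1, h⟩) (v ⟨k, by omega⟩) (v ⟨0, by omega⟩)
      push_cast
      linarith
  have hroot : ∀ i : Fin n, |v i - v ⟨0, i.pos⟩| ≤ n * √G := fun i =>
    (hpath i i.2).trans (by gcongr; exact i.2.le)
  have hpair : ∀ i j, (v i - v j) ^ 2 ≤ 4 * n ^ 2 * G := by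
    intro i j
    have h1 := abs_sub_le (v i) (v ⟨0, i.pos⟩) (v j)
    rw [abs_sub_comm (v ⟨0, i.pos⟩)] at h1
    have h2 : |v i - v j| ≤ 2 * n * √G := by linarith [hroot i, hroot j]
    calc (v i - v j) ^ 2 = |v i - v j| ^ 2 := (sq_abs _).symm
      _ ≤ (2 * n * √G) ^ 2 := by gcongr
      _ = 4 * n ^ 2 * G := by rw [mul_pow, Real.sq_sqrt hG0]; ring
  refine (Finset.sum_le_sum fun i _ => Finset.sum_le_sum fun j _ => hpair i j).trans ?_
  simp
  ring_nf
  rfl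

/-! ### Regular polygons -/

lemma angularForce_add_int_mul_two_pi (φ : ℝ → ℝ) (x : ℝ) (k : ℤ) :
    angularForce φ (x + k * (2 * Real.pi)) = angularForce φ x := by
  simp [angularForce, Real.cos_add_int_mul_two_pi, Real.sin_add_int_mul_two_pi]

/-- The vertices of a regular polygon are balanced, by reflection symmetry. -/
lemma sum_angularForce_regular_polygon {n : ℕ} (φ : ℝ → ℝ) (i : Fin n) :
    ∑ j : Fin n, angularForce φ (2 * Real.pi * (i : ℕ) / n - 2 * Real.pi * (j : ℕ) / n) = 0 := by
  have : NeZero n := ⟨i.pos.ne'⟩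
  have hn : (n : ℝ) ≠ 0 := Nat.cast_ne_zero.2 i.pos.ne'
  -- the reflection `j ↦ 2 i - j` of the polygon fixing the vertex `i`
  have hrefl : ∀ j : Fin n, ∃ k : ℤ, (((i + i - j : Fin n) : ℕ) : ℤ) = i + i - j + k * n := by
    intro j
    rw [Fin.val_sub, Fin.val_add]
    have h1 := Int.emod_add_mul_ediv ((n - (j : ℕ) + ((i : ℕ) + i) % n : ℕ) : ℤ) n
    have h2 := Int.emod_add_mul_ediv (((i : ℕ) + i : ℕ) : ℤ) n
    refine ⟨1 - ((i : ℕ) + i : ℕ) / (n : ℤ) -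
      ((n - (j : ℕ) + ((i : ℕ) + i) % n : ℕ) : ℤ) / (n : ℤ), ?_⟩
    push_cast [j.2.le] at h1 h2 ⊢
    linarith
  have hodd : ∀ j : Fin n,
      angularForce φ (2 * Real.pi * (i : ℕ) / n - 2 * Real.pi * ((i + i - j : Fin n) : ℕ) / n) =
        -angularForce φ (2 * Real.pi * (i : ℕ) / n - 2 * Real.pi * (j : ℕ) / n) := by
    intro j
    obtain ⟨k, hk⟩ := hrefl j
    have hk' : (((i + i - j : Fin n) : ℕ) : ℝ) = (i : ℕ) + (i : ℕ) - (j : ℕ) + k * n := by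
      exact_mod_cast hk
    rw [← angularForce_neg, ← angularForce_add_int_mul_two_pi φ _ k, hk']
    congr 1
    field_simp
    ring
  have hsum := Equiv.sum_comp (Equiv.subLeft (i + i)) fun j : Fin n =>
    angularForce φ (2 * Real.pi * (i : ℕ) / n - 2 * Real.pi * (j : ℕ) / n)
  simp only [Equiv.subLeft_apply, hodd, Finset.sum_neg_distrib] at hsum
  linarith

lemma cos_two_pi_div_five : Real.cos (2 * Real.pi / 5) = (√5 - 1) / 4 := by
  have h : 2 * Real.pi / 5 = 2 * (Real.pi / 5) := by ring
  rw [h, Real.cos_two_mul, Real.cos_pi_div_five]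
  have := Real.sq_sqrt (show (0 : ℝ) ≤ 5 by norm_num)
  linear_combination this / 8

lemma cos_four_pi_div_five : Real.cos (4 * Real.pi / 5) = -(√5 + 1) / 4 := by
  have h : 4 * Real.pi / 5 = Real.pi - Real.pi / 5 := by ring
  rw [h, Real.cos_pi_sub, Real.cos_pi_div_five]
  ring

lemma sqrt_five_bounds : 2.236 < √5 ∧ √5 < 2.24 :=
  ⟨Real.lt_sqrt_of_sq_lt (by norm_num), (Real.sqrt_lt' (by norm_num)).2 (by norm_num)⟩

/-- For small `ε` the regular polygon with at least five vertices is a stable equilibrium: the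
threshold avoids all its chords, and its sides are within the threshold. -/
lemma eventually_isStableEquilibrium_regular_polygon {τ : ℝ} (hτ : 0 < τ) (hτ' : τ < 1 / 4)
    (hchord : ∀ (n : ℕ) (k : ℤ), Real.cos (2 * Real.pi * k / n) ≠ τ) {n : ℕ} (hn : 5 ≤ n) :
    ∀ᶠ ε in 𝓝[>] (0 : ℝ), IsStableEquilibrium (softplus ε τ)
      (fun i : Fin n => 2 * Real.pi * (i : ℕ) / n) := by
  have hn0 : (0 : ℝ) < n := by positivity
  obtain ⟨δ, hδ, hsep⟩ : ∃ δ > 0, ∀ p : Fin n × Fin n, δ ≤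
      |Real.cos (2 * Real.pi * (p.1 : ℕ) / n - 2 * Real.pi * (p.2 : ℕ) / n) - τ| := by
    have : ∀ᶠ r in 𝓝[>] (0 : ℝ), ∀ p : Fin n × Fin n, r ≤
        |Real.cos (2 * Real.pi * (p.1 : ℕ) / n - 2 * Real.pi * (p.2 : ℕ) / n) - τ| := by
      refine eventually_all.2 fun p => (eventually_le_nhds ?_).filter_mono nhdsWithin_le_nhds
      rw [abs_pos, sub_ne_zero]
      have := hchord n ((p.1 : ℕ) - (p.2 : ℕ) : ℤ)
      push_cast at this
      rwa [mul_sub, sub_div] at this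
    obtain ⟨r, h1, h2⟩ := (this.and self_mem_nhdsWithin).exists
    exact ⟨r, h2, h1⟩
  have hK : (0 : ℝ) < 4 * n ^ 4 := by positivity
  filter_upwards [eventually_angularStiffness_softplus_le hτ hδ
    (by positivity : 0 < τ / 2 / (2 * (4 * (n : ℝ) ^ 4)))] with ε hS
  refine isStableEquilibrium_of_poincare hK (half_pos hτ) hδ
    (sum_angularForce_regular_polygon _) (fun i j => ?_) (fun v => ?_) hS
  · rcases le_abs'.1 (hsep (i, j)) with h | h
    · exact Or.inr (by linarith)
    · exact Or.inl (by linarith)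
  · refine poincare_of_path (fun k h => ?_) v
    have hstep : 2 * Real.pi * ((k + 1 : ℕ) : ℝ) / n - 2 * Real.pi * (k : ℝ) / n =
        2 * Real.pi / n := by
      push_cast
      ring
    simp only [hstep]
    have hle : 2 * Real.pi / n ≤ 2 * Real.pi / 5 := by
      gcongr
      exact_mod_cast hn
    have hcos := Real.cos_le_cos_of_nonneg_of_le_pi (by positivity)
      (by linarith [Real.pi_pos]) hle
    rw [cos_two_pi_div_five] at hcos
    linarith [sqrt_five_bounds.1]

/-! ### Five clusters near the regular pentagon -/

/-- Poincaré inequality for points grouped in clusters of comparable sizes, any two of which have a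
common neighbour in `R`: the difference of two values is split at each point of that
neighbour and averaged. -/
lemma poincare_of_clusters {n : ℕ} {κ : Type*} [Fintype κ] [DecidableEq κ] (c : Fin n → κ)
    {R : κ → κ → Prop} [DecidableRel R] (hR : ∀ a b, ∃ e, R a e ∧ R e b)
    (hcard : ∀ e, (n : ℝ) / 10 ≤ (Finset.univ.filter fun p => c p = e).card) (v : Fin n → ℝ) :
    ∑ i, ∑ j, (v i - v j) ^ 2 ≤
      (40 : ℝ) * ∑ i, ∑ j, if R (c i) (c j) then (v i - v j) ^ 2 else 0 := by
  rcases Nat.eq_zero_or_pos n with rfl | hn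
  · simp
  set g : Fin n → Fin n → ℝ := fun i j => if R (c i) (c j) then (v i - v j) ^ 2 else 0 with hg
  have hnn : ∀ i j, 0 ≤ g i j := fun i j => by
    simp only [hg]
    split_ifs <;> positivity
  have hpair : ∀ i j, (n : ℝ) / 10 * (v i - v j) ^ 2 ≤ 2 * ∑ r, (g i r + g r j) := by
    intro i j
    obtain ⟨e, h1, h2⟩ := hR (c i) (c j)
    calc (n : ℝ) / 10 * (v i - v j) ^ 2
        ≤ (Finset.univ.filter fun p => c p = e).card * (v i - v j) ^ 2 := by
          gcongr
          exact hcard e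
      _ = ∑ r ∈ Finset.univ.filter fun p => c p = e, (v i - v j) ^ 2 := by
          rw [Finset.sum_const, nsmul_eq_mul]
      _ ≤ ∑ r ∈ Finset.univ.filter fun p => c p = e, 2 * (g i r + g r j) := by
          refine Finset.sum_le_sum fun r hr => ?_
          have hr : c r = e := (Finset.mem_filter.1 hr).2
          simp only [hg, hr, if_pos h1, if_pos h2]
          nlinarith [sq_nonneg ((v i - v r) - (v r - v j))]
      _ ≤ ∑ r, 2 * (g i r + g r j) :=
          Finset.sum_le_sum_of_subset_of_nonneg (Finset.filter_subset _ _)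
            fun r _ _ => by linarith [hnn i r, hnn r j]
      _ = _ := by rw [Finset.mul_sum]
  have hsum := Finset.sum_le_sum fun i (_ : i ∈ Finset.univ) =>
    Finset.sum_le_sum fun j (_ : j ∈ Finset.univ) => hpair i j
  have e1 : ∑ i, ∑ j, 2 * ∑ r, (g i r + g r j) = 4 * n * ∑ i, ∑ j, g i j := by
    simp only [Finset.sum_add_distrib, mul_add, ← Finset.mul_sum]
    have h2 : ∑ i : Fin n, ∑ j, ∑ r, g r j = n * ∑ i, ∑ j, g i j := by
      rw [Finset.sum_const, Finset.card_univ, Fintype.card_fin, nsmul_eq_mul, Finset.sum_comm]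
    rw [h2]
    simp [← Finset.mul_sum]
    ring
  simp only [← Finset.mul_sum] at hsum
  simp only [← Finset.mul_sum] at e1
  rw [e1] at hsum
  have hn' : (0 : ℝ) < n := Nat.cast_pos.2 hn
  have : (n : ℝ) / 10 * ∑ i, ∑ j, (v i - v j) ^ 2 ≤ n / 10 * (40 * ∑ i, ∑ j, g i j) := by
    linarith
  exact le_of_mul_le_mul_left this (by positivity)

/-- The vertices of the regular pentagon, as angles. -/
def pentagon (a : Fin 5) : ℝ := 2 * Real.pi / 5 * (a : ℕ)

/-- Orientation of a side of the pentagon: `1` for `(a + 1, a)`, `-1` for `(a, a + 1)`, and `0`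
for pairs which are not sides. -/
def sideSign (a b : Fin 5) : ℝ := if a = b + 1 then 1 else if b = a + 1 then -1 else 0

/-- Equal or neighbouring vertices of the pentagon. -/
def IsNear (a b : Fin 5) : Prop := a = b ∨ a = b + 1 ∨ b = a + 1

instance : DecidableRel IsNear := fun a b => by unfold IsNear; infer_instance

lemma cos_pentagon_sub_of_side {a b : Fin 5} (h : a = b + 1 ∨ b = a + 1) (x : ℝ) :
    Real.cos (pentagon a - pentagon b + x) = Real.cos (sideSign a b * (2 * Real.pi / 5) + x) := by
  have key : ∃ k : ℤ, pentagon a - pentagon b + x =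
      sideSign a b * (2 * Real.pi / 5) + x + k * (2 * Real.pi) := by
    revert h
    fin_cases a <;> fin_cases b <;> simp [pentagon, sideSign] <;>
      first
      | exact ⟨0, by ring1⟩
      | exact ⟨1, by ring1⟩
      | exact ⟨-1, by ring1⟩
  obtain ⟨k, hk⟩ := key
  rw [hk, Real.cos_add_int_mul_two_pi]

lemma sideSign_of_side {a b : Fin 5} (h : a = b + 1 ∨ b = a + 1) :
    sideSign a b = 1 ∨ sideSign a b = -1 := by
  unfold sideSign
  split_ifs <;> simp_all

lemma sideSign_of_not_side {a b : Fin 5} (h : ¬(a = b + 1 ∨ b = a + 1)) : sideSign a b = 0 := by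
  unfold sideSign
  split_ifs <;> simp_all

lemma cos_pentagon_sub_of_not_isNear {a b : Fin 5} (h : ¬ IsNear a b) :
    Real.cos (pentagon a - pentagon b) = Real.cos (4 * Real.pi / 5) := by
  have key : ∃ k : ℤ, pentagon a - pentagon b = 4 * Real.pi / 5 + k * (2 * Real.pi) ∨
      pentagon a - pentagon b = -(4 * Real.pi / 5) + k * (2 * Real.pi) := by
    revert h
    fin_cases a <;> fin_cases b <;> simp [pentagon, IsNear] <;>
      first
      | exact ⟨0, Or.inl (by ring1)⟩
      | exact ⟨0, Or.inr (by ring1)⟩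
      | exact ⟨1, Or.inl (by ring1)⟩
      | exact ⟨1, Or.inr (by ring1)⟩
      | exact ⟨-1, Or.inl (by ring1)⟩
  obtain ⟨k, hk | hk⟩ := key
  · rw [hk, Real.cos_add_int_mul_two_pi]
  · rw [hk, Real.cos_add_int_mul_two_pi, Real.cos_neg]

lemma abs_cos_sub_cos_le (x y : ℝ) : |Real.cos (x + y) - Real.cos x| ≤ |y| := by
  simpa using Real.abs_cos_sub_cos_le (x + y) x

/-- Displacements of at most `1/50` per vertex change an angle by at most `1/25`. In this range, near
vertices stay within the threshold and other pairs beyond it. -/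
lemma cos_pentagon_bounds {τ : ℝ} (h1 : 1 / 5 < τ) (h2 : τ < 1 / 4) (a b : Fin 5) {x : ℝ}
    (hx : |x| ≤ 1 / 25) (hab : a = b → x = 0) :
    (IsNear a b → τ + 1 / 100 ≤ Real.cos (pentagon a - pentagon b + x)) ∧
      (¬ IsNear a b → Real.cos (pentagon a - pentagon b + x) ≤ τ - 1 / 100) := by
  have hlip := abs_le.1 ((abs_cos_sub_cos_le (pentagon a - pentagon b) x).trans hx)
  have h5 := sqrt_five_bounds
  constructor
  · rintro (h | h)
    · rw [hab h, h]
      norm_num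
      linarith
    · have h0 := cos_pentagon_sub_of_side h 0
      rw [add_zero, add_zero] at h0
      have h3 : Real.cos (pentagon a - pentagon b) = (√5 - 1) / 4 := by
        rw [h0, ← cos_two_pi_div_five]
        rcases sideSign_of_side h with h | h
        · rw [h, one_mul]
        · rw [h, neg_one_mul, Real.cos_neg]
      linarith [hlip.1]
  · intro h
    have h3 := cos_pentagon_sub_of_not_isNear h
    rw [cos_four_pi_div_five] at h3
    linarith [hlip.2]

/-- Strict concavity of the cosine near the side of the pentagon. -/
lemma cos_side_le {a b : Fin 5} (h : a = b + 1 ∨ b = a + 1) {x : ℝ} (hx : |x| ≤ 1 / 25) :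
    Real.cos (pentagon a - pentagon b + x) ≤ Real.cos (pentagon a - pentagon b) -
      sideSign a b * Real.sin (2 * Real.pi / 5) * x - x ^ 2 / 10 := by
  have h0 := cos_pentagon_sub_of_side h 0
  rw [add_zero, add_zero] at h0
  rw [cos_pentagon_sub_of_side h, h0]
  have hx1 : |x| ≤ 1 := by linarith
  have hc := abs_le.1 (Real.cos_bound hx1)
  have hs := abs_le.1 (Real.sin_bound hx1)
  have hx2 : |x| ^ 2 = x ^ 2 := sq_abs x
  have hx4 : |x| ^ 4 ≤ x ^ 2 / 625 := by
    calc |x| ^ 4 = |x| ^ 2 * x ^ 2 := by rw [← hx2]; ring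
      _ ≤ (1 / 25) ^ 2 * x ^ 2 := by gcongr
      _ = x ^ 2 / 625 := by ring
  have hx3 : |x ^ 3| ≤ x ^ 2 / 25 := by
    rw [abs_pow]
    calc |x| ^ 3 = |x| * x ^ 2 := by rw [← hx2]; ring
      _ ≤ (1 / 25) * x ^ 2 := by gcongr
      _ = x ^ 2 / 25 := by ring
  have hx3' := abs_le.1 hx3
  have hcos : Real.cos x ≤ 1 - 49 / 100 * x ^ 2 := by nlinarith [sq_nonneg x]
  have hsin : |Real.sin x - x| ≤ x ^ 2 / 100 := by
    rw [abs_le]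
    constructor <;> nlinarith [sq_nonneg x]
  have hβ : (0.309 : ℝ) ≤ Real.cos (2 * Real.pi / 5) := by
    rw [cos_two_pi_div_five]
    linarith [sqrt_five_bounds.1]
  have hprod : |Real.sin (2 * Real.pi / 5) * (Real.sin x - x)| ≤ x ^ 2 / 100 := by
    rw [abs_mul]
    exact (mul_le_of_le_one_left (abs_nonneg _) (Real.abs_sin_le_one _)).trans hsin
  have hprod' := abs_le.1 hprod
  rcases sideSign_of_side h with h | h
  · rw [h, one_mul, Real.cos_add]
    nlinarith [sq_nonneg x]
  · rw [h, neg_one_mul, Real.cos_add, Real.cos_neg, Real.sin_neg]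
    nlinarith [sq_nonneg x]

/-- Second-order upper bound for the interaction of the clusters `a` and `b`, of weight `M ≈ q ^ 2`,
under a displacement of their angle by `x`. The linear term cancels upon summation over all pairs;
the last term collects the error in `M` and the distance `ε` of softplus from its limit
`max (t - τ) 0`. -/
lemma pair_energy_le {ε τ q M : ℝ} (hε : 0 < ε) (h1 : 1 / 5 < τ) (h2 : τ < 1 / 4) (hq : 1 ≤ q)
    (hM : q ^ 2 ≤ M) (hM' : M ≤ q ^ 2 + 3 * q) (a b : Fin 5) {x : ℝ} (hx : |x| ≤ 1 / 25)
    (hab : a = b → x = 0) :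
    M * softplus ε τ (Real.cos (pentagon a - pentagon b + x)) ≤
      M * softplus ε τ (Real.cos (pentagon a - pentagon b)) +
        q ^ 2 * (-(Real.sin (2 * Real.pi / 5) * (sideSign a b * x)) - (sideSign a b * x) ^ 2 / 10) +
        (3 / 25 * q + 4 * q ^ 2 * ε) := by
  have hM0 : 0 < M := by nlinarith
  have hM4 : M * ε ≤ 4 * q ^ 2 * ε := by
    gcongr
    nlinarith
  obtain ⟨hn, hf⟩ := cos_pentagon_bounds h1 h2 a b hx hab
  obtain ⟨hn0, hf0⟩ := cos_pentagon_bounds h1 h2 a b (x := 0) (by norm_num) fun _ => rfl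
  rw [add_zero] at hn0 hf0
  by_cases hside : a = b + 1 ∨ b = a + 1
  · have hX := cos_side_le hside hx
    have hle := softplus_le hε τ (Real.cos (pentagon a - pentagon b + x))
    rw [max_eq_left (by linarith [hn (Or.inr hside)])] at hle
    have hge := sub_le_softplus hε τ (Real.cos (pentagon a - pentagon b))
    have hlip := abs_le.1 ((abs_cos_sub_cos_le (pentagon a - pentagon b) x).trans hx)
    have hσ : sideSign a b ^ 2 = 1 := by
      rcases sideSign_of_side hside with h | h <;> rw [h] <;> norm_num
    rw [mul_pow, hσ, one_mul]
    set X := Real.cos (pentagon a - pentagon b + x) - Real.cos (pentagon a - pentagon b) with hXdef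
    have hX' : X ≤ -(Real.sin (2 * Real.pi / 5) * (sideSign a b * x)) - x ^ 2 / 10 := by
      rw [hXdef]
      linarith
    have hMX : M * X ≤ q ^ 2 * X + 3 / 25 * q := by nlinarith [hlip.2]
    have hqX := mul_le_mul_of_nonneg_left hX' (sq_nonneg q)
    have hsoft : M * softplus ε τ (Real.cos (pentagon a - pentagon b + x)) ≤
        M * (softplus ε τ (Real.cos (pentagon a - pentagon b)) + X + ε) := by
      gcongr
      linarith
    linarith
  · rw [sideSign_of_not_side hside]
    simp only [zero_mul, mul_zero, neg_zero, sub_zero, ne_eq, OfNat.ofNat_ne_zero,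
      not_false_eq_true, zero_pow, zero_div, add_zero]
    have hc : 0 ≤ 4 * q ^ 2 * ε := by positivity
    by_cases hab' : a = b
    · rw [hab hab', add_zero]
      linarith
    · have hfar : ¬ IsNear a b := fun h => h.elim hab' hside
      have hle := softplus_le hε τ (Real.cos (pentagon a - pentagon b + x))
      rw [max_eq_right (by linarith [hf hfar])] at hle
      have hge := softplus_nonneg hε τ (Real.cos (pentagon a - pentagon b))
      have := mul_le_mul_of_nonneg_left hle hM0.le
      have := mul_nonneg hM0.le hge
      linarith

/-- The oriented displacements of the sides add up to zero around the pentagon, so only the quadratic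
terms survive. -/
lemma sum_side_quadratic (s q : ℝ) (y : Fin 5 → ℝ) :
    ∑ a, ∑ b, q ^ 2 * (-(s * (sideSign a b * (y a - y b))) -
        (sideSign a b * (y a - y b)) ^ 2 / 10) =
      -(q ^ 2 / 5 * ((y 1 - y 0) ^ 2 + (y 2 - y 1) ^ 2 + (y 3 - y 2) ^ 2 + (y 4 - y 3) ^ 2 +
        (y 0 - y 4) ^ 2)) := by
  simp [Fin.sum_univ_five, sideSign]
  ring

/-- With nearly equal weights, displacing a vertex of the pentagon by exactly `1/50` lowers the
energy: the quadratic gain is at least `q ^ 2 / (5 * 10 ^ 4)`, and the total error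
`25 * (3 / 25 * q + 4 * q ^ 2 * ε)` is smaller for `q ≥ 10 ^ 6` and `ε ≤ 10 ^ (-8)`. -/
lemma energy_lt_pentagon {ε τ q : ℝ} (hε : 0 < ε) (hε' : ε ≤ 1 / 10 ^ 8) (h1 : 1 / 5 < τ)
    (h2 : τ < 1 / 4) (hq : 10 ^ 6 ≤ q) {m : Fin 5 → ℝ} (hm : ∀ a, q ≤ m a)
    (hm' : ∀ a, m a ≤ q + 1) {y : Fin 5 → ℝ} (hy0 : y 0 = 0) (hy : ∀ a, |y a| ≤ 1 / 50)
    (hy' : ∃ a, |y a| = 1 / 50) :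
    ∑ a, ∑ b, m a * m b * softplus ε τ (Real.cos (pentagon a - pentagon b + (y a - y b))) <
      ∑ a, ∑ b, m a * m b * softplus ε τ (Real.cos (pentagon a - pentagon b)) := by
  have hle := Finset.sum_le_sum fun a (_ : a ∈ Finset.univ) =>
    Finset.sum_le_sum fun b (_ : b ∈ Finset.univ) => pair_energy_le hε h1 h2
      (q := q) (M := m a * m b) (by linarith) (by nlinarith [hm a, hm b])
      (by nlinarith [hm a, hm b, hm' a, hm' b]) a b (x := y a - y b)
      (by linarith [abs_sub (y a) (y b), hy a, hy b]) (fun h => by rw [h, sub_self])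
  simp only [Finset.sum_add_distrib (M := ℝ)] at hle
  rw [sum_side_quadratic] at hle
  simp only [Finset.sum_const, Finset.card_univ, Fintype.card_fin, nsmul_eq_mul] at hle
  set S := (y 1 - y 0) ^ 2 + (y 2 - y 1) ^ 2 + (y 3 - y 2) ^ 2 + (y 4 - y 3) ^ 2 +
    (y 0 - y 4) ^ 2 with hSdef
  -- Cauchy-Schwarz along the sides from the fixed vertex `0` to the displaced one
  have hS : 1 / 10 ^ 4 ≤ S := by
    obtain ⟨a, ha⟩ := hy'
    have ha2 : y a ^ 2 = (1 / 50) ^ 2 := by rw [← sq_abs, ha]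
    have : y a ^ 2 ≤ 4 * S := by
      rw [hSdef, hy0]
      fin_cases a
      · show y 0 ^ 2 ≤ _
        rw [hy0, zero_pow two_ne_zero]
        positivity
      · show y 1 ^ 2 ≤ _
        nlinarith [sq_nonneg (y 2 - y 1), sq_nonneg (y 3 - y 2), sq_nonneg (y 4 - y 3),
          sq_nonneg (y 4), sq_nonneg (y 1)]
      · show y 2 ^ 2 ≤ _
        nlinarith [sq_nonneg (y 2 - y 1 - y 1), sq_nonneg (y 2 - y 1), sq_nonneg (y 3 - y 2),
          sq_nonneg (y 4 - y 3), sq_nonneg (y 4), sq_nonneg (y 1)]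
      · show y 3 ^ 2 ≤ _
        nlinarith [sq_nonneg (y 4 - y 3 + y 4), sq_nonneg (y 2 - y 1), sq_nonneg (y 3 - y 2),
          sq_nonneg (y 4 - y 3), sq_nonneg (y 4), sq_nonneg (y 1)]
      · show y 4 ^ 2 ≤ _
        nlinarith [sq_nonneg (y 2 - y 1), sq_nonneg (y 3 - y 2), sq_nonneg (y 4 - y 3),
          sq_nonneg (y 4), sq_nonneg (y 1)]
    nlinarith
  have hq2 : 0 < q ^ 2 := by nlinarith
  have e1 : q ^ 2 / 5 * (1 / 10 ^ 4) ≤ q ^ 2 / 5 * S := by gcongr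
  have e2 : 4 * q ^ 2 * ε ≤ 4 * q ^ 2 * (1 / 10 ^ 8) := by gcongr
  have e3 : 10 ^ 6 * q ≤ q ^ 2 := by nlinarith
  push_cast at hle
  norm_num at hle e1 e2 e3
  linarith

/-- Five clusters of nearly equal weights have a balanced position near the regular pentagon: the
maximum of the energy over a neighbourhood of the pentagon is interior. -/
lemma exists_balanced_near_pentagon {ε τ q : ℝ} (hε : 0 < ε) (hε' : ε ≤ 1 / 10 ^ 8)
    (h1 : 1 / 5 < τ) (h2 : τ < 1 / 4) (hq : 10 ^ 6 ≤ q) {m : Fin 5 → ℝ} (hm : ∀ a, q ≤ m a)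
    (hm' : ∀ a, m a ≤ q + 1) :
    ∃ y : Fin 5 → ℝ, (∀ a, |y a| ≤ 1 / 50) ∧
      ∀ a, ∑ b, m b * angularForce (softplus ε τ) (pentagon a + y a - (pentagon b + y b)) = 0 := by
  set f := softplus ε τ with hf
  have hfd : Differentiable ℝ f := fun t => (hasDerivAt_softplus hε τ t).differentiableAt
  have hm0 : ∀ a, 0 < m a := fun a => by linarith [hm a]
  let E : (Fin 5 → ℝ) → ℝ := fun y =>
    ∑ a, ∑ b, m a * m b * f (Real.cos (pentagon a - pentagon b + (y a - y b)))
  have hEc : Continuous E := by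
    have := hfd.continuous
    fun_prop
  -- the rotational freedom is removed by fixing the vertex `0`
  let hi : Fin 5 → ℝ := fun a => if a = 0 then 0 else 1 / 50
  have hhi0 : hi 0 = 0 := if_pos rfl
  have hhi : ∀ a, a ≠ 0 → hi a = 1 / 50 := fun a ha => if_neg ha
  have hhinn : ∀ a, 0 ≤ hi a := fun a => by
    rcases eq_or_ne a 0 with rfl | ha
    · rw [hhi0]
    · rw [hhi a ha]; norm_num
  have hhile : ∀ a, hi a ≤ 1 / 50 := fun a => by
    rcases eq_or_ne a 0 with rfl | ha
    · rw [hhi0]; norm_num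
    · rw [hhi a ha]
  obtain ⟨y, hyD, hymax⟩ := (isCompact_Icc (a := -hi) (b := hi)).exists_isMaxOn
    ⟨0, fun a => by simpa using hhinn a, fun a => by simpa using hhinn a⟩ hEc.continuousOn
  have hya : ∀ a, |y a| ≤ hi a := fun a => abs_le.2 ⟨hyD.1 a, hyD.2 a⟩
  have hy0 : y 0 = 0 := abs_nonpos_iff.1 ((hya 0).trans hhi0.le)
  have hyle : ∀ a, |y a| ≤ 1 / 50 := fun a => (hya a).trans (hhile a)
  have hylt : ∀ a, |y a| < 1 / 50 := by
    by_contra! hcon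
    obtain ⟨a, ha⟩ := hcon
    have hlt := energy_lt_pentagon hε hε' h1 h2 hq hm hm' hy0 hyle ⟨a, le_antisymm (hyle a) ha⟩
    have hge : E 0 ≤ E y :=
      hymax ⟨fun a => by simpa using hhinn a, fun a => by simpa using hhinn a⟩
    simp only [E, Pi.zero_apply, sub_zero, add_zero] at hge
    linarith
  let F : Fin 5 → Fin 5 → ℝ := fun a b =>
    m a * m b * angularForce f (pentagon a - pentagon b + (y a - y b))
  have hFanti : ∀ a b, F b a = -F a b := by
    intro a b
    simp only [F]
    rw [show pentagon b - pentagon a + (y b - y a) = -(pentagon a - pentagon b + (y a - y b)) by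
      ring, angularForce_neg]
    ring
  have hrow : ∀ a, a ≠ 0 → ∑ b, F a b = 0 := by
    intro a ha
    let e : Fin 5 → ℝ := Pi.single a 1
    have hder : HasDerivAt (fun t : ℝ => E (y + t • e)) (∑ b, ∑ c, (e b - e c) * F b c) 0 := by
      refine HasDerivAt.fun_sum fun b _ => HasDerivAt.fun_sum fun c _ => ?_
      have hline : HasDerivAt (fun t : ℝ => pentagon b - pentagon c +
          ((y + t • e) b - (y + t • e) c)) (e b - e c) 0 := by
        have := ((((hasDerivAt_id (0 : ℝ)).mul_const (e b)).const_add (y b)).sub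
          (((hasDerivAt_id (0 : ℝ)).mul_const (e c)).const_add (y c))).const_add
          (pentagon b - pentagon c)
        simpa using! this
      have h3 := ((hasDerivAt_comp_cos hfd _).comp (0 : ℝ) hline).const_mul (m b * m c)
      refine h3.congr_deriv ?_
      simp only [F, zero_smul, add_zero]
      ring
    have hloc : IsLocalMax (fun t : ℝ => E (y + t • e)) 0 := by
      have hnear : ∀ᶠ t : ℝ in 𝓝 0, |y a + t| < 1 / 50 := by
        have hc : Continuous fun t : ℝ => |y a + t| := by fun_prop
        exact hc.continuousAt.eventually_lt continuousAt_const (by simpa using hylt a)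
      filter_upwards [hnear] with t ht
      have hmem : ∀ b, |(y + t • e) b| ≤ hi b := by
        intro b
        rcases eq_or_ne b a with rfl | hb
        · simpa [e, hhi b ha] using ht.le
        · simpa [e, hb] using hya b
      have := hymax (a := y + t • e) ⟨fun b => (abs_le.1 (hmem b)).1, fun b => (abs_le.1 (hmem b)).2⟩
      simpa using this
    have hzero := hloc.hasDerivAt_eq_zero hder
    rw [← sum_mul_sum_of_antisymm e hFanti] at hzero
    simpa [e, Pi.single_apply] using hzero
  -- the total force vanishes, hence so does the force at the fixed vertex
  have hrow' : ∀ a, ∑ b, F a b = 0 := by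
    intro a
    rcases eq_or_ne a 0 with rfl | ha
    · have htot := sum_sum_eq_zero_of_antisymm hFanti
      rwa [Finset.sum_eq_single 0 (fun b _ hb => hrow b hb) (by simp)] at htot
    · exact hrow a ha
  refine ⟨y, hyle, fun a => ?_⟩
  have h3 := hrow' a
  simp only [F, mul_assoc, ← Finset.mul_sum] at h3
  have h4 := (mul_eq_zero.1 h3).resolve_left (hm0 a).ne'
  simpa only [add_sub_add_comm] using h4

/-- The index modulo five: the cluster to which a point is assigned. -/
def cluster {n : ℕ} (p : Fin n) : Fin 5 := ⟨p % 5, Nat.mod_lt _ (by norm_num)⟩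

lemma card_cluster (n : ℕ) (a : Fin 5) :
    n / 5 ≤ (Finset.univ.filter fun p : Fin n => cluster p = a).card ∧
      (Finset.univ.filter fun p : Fin n => cluster p = a).card ≤ n / 5 + 1 := by
  have hcard : (Finset.univ.filter fun p : Fin n => cluster p = a).card =
      n.count (· ≡ a [MOD 5]) := by
    rw [Nat.count_eq_card_filter_range, Finset.card_filter, Finset.card_filter,
      ← Fin.sum_univ_eq_sum_range (fun p => if p ≡ a [MOD 5] then 1 else 0)]
    refine Finset.sum_congr rfl fun p _ => ?_
    congr 1
    simp [cluster, Fin.ext_iff, Nat.ModEq, Nat.mod_eq_of_lt a.2]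
  rw [hcard, Nat.count_modEq_card _ (by norm_num)]
  split_ifs <;> omega

/-- For small `ε`, and all large `n` simultaneously, some arrangement in five clusters near the
regular pentagon is a stable equilibrium. -/
lemma eventually_exists_isStableEquilibrium_clusters {τ : ℝ} (h1 : 1 / 5 < τ) (h2 : τ < 1 / 4) :
    ∀ᶠ ε in 𝓝[>] (0 : ℝ), ∀ n : ℕ, 5 * 10 ^ 6 ≤ n →
      ∃ θ : Fin n → ℝ, IsStableEquilibrium (softplus ε τ) θ ∧ ∃ i j, Real.cos (θ i - θ j) ≠ 1 := by
  have hτ : 0 < τ := by linarith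
  have hsmall : ∀ᶠ ε in 𝓝[>] (0 : ℝ), ε ≤ 1 / 10 ^ 8 :=
    (eventually_le_nhds (by norm_num)).filter_mono nhdsWithin_le_nhds
  filter_upwards [eventually_angularStiffness_softplus_le hτ (by norm_num : (0 : ℝ) < 1 / 100)
    (by positivity : 0 < τ / 2 / (2 * 40)), hsmall, self_mem_nhdsWithin] with ε hS hε' hε n hn
  have hε : 0 < ε := hε
  set m : Fin 5 → ℝ := fun a => ((Finset.univ.filter fun p : Fin n => cluster p = a).card : ℝ)
    with hmdef
  have hq : (10 : ℝ) ^ 6 ≤ (n / 5 : ℕ) := by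
    have : 10 ^ 6 ≤ n / 5 := by omega
    exact_mod_cast this
  obtain ⟨y, hy, hbal⟩ := exists_balanced_near_pentagon (q := ((n / 5 : ℕ) : ℝ)) (m := m) hε hε'
    h1 h2 hq (fun a => by simp only [hmdef]; exact_mod_cast (card_cluster n a).1)
    (fun a => by simp only [hmdef]; exact_mod_cast (card_cluster n a).2)
  have hbd : ∀ a b, (IsNear a b → τ + 1 / 100 ≤ Real.cos (pentagon a + y a - (pentagon b + y b))) ∧
      (¬ IsNear a b → Real.cos (pentagon a + y a - (pentagon b + y b)) ≤ τ - 1 / 100) := by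
    intro a b
    rw [add_sub_add_comm]
    exact cos_pentagon_bounds h1 h2 a b (by linarith [abs_sub (y a) (y b), hy a, hy b])
      fun h => by rw [h, sub_self]
  refine ⟨fun p => pentagon (cluster p) + y (cluster p), ?_, ?_⟩
  · refine isStableEquilibrium_of_poincare (K := 40) (τ := τ) (δ := 1 / 100) (a := τ / 2)
      (by norm_num) (half_pos hτ) (by norm_num) (fun i => ?_) (fun i j => ?_) (fun v => ?_) hS
    · rw [← hbal (cluster i), ← Finset.sum_fiberwise Finset.univ cluster]
      refine Finset.sum_congr rfl fun b _ => ?_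
      rw [hmdef, ← nsmul_eq_mul, ← Finset.sum_const]
      refine Finset.sum_congr rfl fun p hp => ?_
      rw [(Finset.mem_filter.1 hp).2]
    · by_cases h : IsNear (cluster i) (cluster j)
      · exact Or.inl ((hbd _ _).1 h)
      · exact Or.inr ((hbd _ _).2 h)
    · have hiff : ∀ a b, τ < Real.cos (pentagon a + y a - (pentagon b + y b)) ↔ IsNear a b := by
        intro a b
        by_cases h : IsNear a b
        · exact iff_of_true (by linarith [(hbd a b).1 h]) h
        · exact iff_of_false (by linarith [(hbd a b).2 h]) h
      simp only [hiff]
      refine poincare_of_clusters cluster (by decide) (fun e => ?_) v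
      have h3 : n ≤ 10 * (Finset.univ.filter fun p : Fin n => cluster p = e).card := by
        have := (card_cluster n e).1
        omega
      have h4 : (n : ℝ) ≤ 10 * (Finset.univ.filter fun p : Fin n => cluster p = e).card := by
        exact_mod_cast h3
      linarith
  · refine ⟨⟨0, by omega⟩, ⟨2, by omega⟩, ?_⟩
    have h3 := (hbd (cluster (⟨0, by omega⟩ : Fin n)) (cluster (⟨2, by omega⟩ : Fin n))).2
      (by simp [cluster, IsNear])
    linarith

/-- Countably many chord cosines of regular polygons leave room for a threshold. -/
lemma exists_threshold : ∃ τ : ℝ, 1 / 5 < τ ∧ τ < 1 / 4 ∧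
    ∀ (n : ℕ) (k : ℤ), Real.cos (2 * Real.pi * k / n) ≠ τ := by
  have hcount : (Set.range fun p : ℕ × ℤ => Real.cos (2 * Real.pi * p.2 / p.1)).Countable :=
    Set.countable_range _
  obtain ⟨τ, hτ, hne⟩ := (hcount.dense_compl ℝ).exists_mem_open isOpen_Ioo
    (⟨9 / 40, by norm_num, by norm_num⟩ : (Set.Ioo (1 / 5 : ℝ) (1 / 4)).Nonempty)
  exact ⟨τ, hne.1, hne.2, fun n k h => hτ ⟨(n, k), h⟩⟩

end SphereSync

end

theorem mainTheorem2 :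
    (∀ ε τ : ℝ, 0 < ε → τ ∈ Set.Ioo (-1 : ℝ) 1 →
      AnalyticOnNhd ℝ (SphereSync.softplus ε τ) Set.univ ∧
      ∀ t : ℝ, 0 < deriv (SphereSync.softplus ε τ) t ∧
        0 < deriv (deriv (SphereSync.softplus ε τ)) t) ∧
    ∃ ε τ : ℝ, 0 < ε ∧ τ ∈ Set.Ioo (-1 : ℝ) 1 ∧
      ∀ n : ℕ, 5 ≤ n →
        ∃ B : Set (SphereSync.Config 2 n),
          MeasurableSet B ∧ 0 < SphereSync.uniformConfig 2 n B ∧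
          ∀ X₀ ∈ B, ∃ Y : SphereSync.Config 2 n,
            SphereSync.IsSpuriousLocalMax (SphereSync.unitWeights n)
              (SphereSync.softplus ε τ) Y ∧
            ¬ SphereSync.Synchronized Y ∧
            SphereSync.FlowConverges (SphereSync.unitWeights n)
              (SphereSync.softplus ε τ) X₀ Y := by
  refine ⟨fun ε τ hε _ => ⟨SphereSync.analyticOnNhd_softplus ε τ, fun t =>
    ⟨SphereSync.deriv_softplus_pos hε τ t, SphereSync.deriv_deriv_softplus_pos hε τ t⟩⟩, ?_⟩
  obtain ⟨τ, h1, h2, hchord⟩ := SphereSync.exists_threshold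
  have hτ : 0 < τ := by linarith
  have hsmall : ∀ᶠ ε in 𝓝[>] (0 : ℝ), ∀ n ∈ Set.Iio (5 * 10 ^ 6), 5 ≤ n →
      SphereSync.IsStableEquilibrium (SphereSync.softplus ε τ)
        (fun i : Fin n => 2 * Real.pi * (i : ℕ) / n) :=
    (eventually_all_finite (Set.finite_Iio _)).2 fun n _ => by
      by_cases hn : 5 ≤ n
      · filter_upwards [SphereSync.eventually_isStableEquilibrium_regular_polygon hτ h2 hchord hn]
          with ε h _ using h
      · exact Eventually.of_forall fun _ h => absurd h hn
  obtain ⟨ε, ⟨hlarge, hsmall⟩, hε⟩ :=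
    (((SphereSync.eventually_exists_isStableEquilibrium_clusters h1 h2).and hsmall).and
      self_mem_nhdsWithin).exists
  have hε : 0 < ε := hε
  refine ⟨ε, τ, hε, ⟨by linarith, by linarith⟩, fun n hn => ?_⟩
  have hstable : ∃ θ : Fin n → ℝ, SphereSync.IsStableEquilibrium (SphereSync.softplus ε τ) θ ∧
      ∃ i j, Real.cos (θ i - θ j) ≠ 1 := by
    rcases lt_or_ge n (5 * 10 ^ 6) with hlt | hge
    · refine ⟨_, hsmall n hlt hn, ⟨1, by omega⟩, ⟨0, by omega⟩, fun h => ?_⟩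
      have hn' : (5 : ℝ) ≤ n := by exact_mod_cast hn
      have hpos : 0 < 2 * Real.pi / n := by positivity
      have hlt : 2 * Real.pi / n < 2 * Real.pi := by
        rw [div_lt_iff₀ (by linarith)]
        nlinarith [Real.pi_pos]
      simp only [Nat.cast_one, mul_one, Nat.cast_zero, mul_zero, zero_div, sub_zero] at h
      rw [Real.cos_eq_one_iff_of_lt_of_lt (by linarith) hlt] at h
      linarith
    · exact hlarge n hge
  obtain ⟨θ, hθ, hne⟩ := hstable
  exact hθ.exists_basin (SphereSync.contDiff_softplus ε τ) (SphereSync.strictMono_softplus hε τ) hne
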